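/- Setting. Let $p_{\mathrm{nu}}, p_{\mathrm{de}}$ be probability densities (with respect to Lebesgue measure) on $\mathbb{R}^d$, strictly positive exactly on $\mathcal{X}^{\mathrm{nu}}$, $\mathcal{X}^{\mathrm{de}}$ respectively, with $\mathcal{X}^{\mathrm{nu}}\subseteq\mathcal{X}^{\mathrm{de}}$. Let $\overline{R}=\sup_{x\in\mathcal{X}^{\mathrm{de}}} p_{\mathrm{nu}}(x)/p_{\mathrm{de}}(x)<\infty$, let $0<C<1/\overline{R}$ and $0\le b_r<\overline{R}<B_r$, and put $I_r=(b_r,B_r)$. Let $f:I_r\to\mathbb{R}$ be twice continuously differentiable and convex with bounded derivative. Define $$\ell_1(t)=f'(t)t-f(t),\qquad \tilde f(t)=f'(t)-C\ell_1(t),\qquad \ell_2=-\tilde f .$$ Assume that on $I_r$ the function $\tilde f$ is bounded from above, that $\ell_1\ge 0$, that $\ell_1,\ell_2$ are Lipschitz, and that $B_\ell:=\sup_{t\in I_r}\max\{|\ell_1(t)|,|\ell_2(t)|\}<\infty$. Hypothesis class. Assume $\|x\|\le B_p$ for all $x\in\mathcal{X}^{\mathrm{de}}$. Let $\mathcal{H}$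 be a set of real-valued bias-free networks of depth $L\ge1$, $r(x)=W_L\varphi_{L-1}(W_{L-1}\cdots\varphi_1(W_1x))$, of arbitrary widths, with Frobenius norms $\|W_j\|_F\le B_{W_j}$ ($B_{W_j}\ge0$) and with fixed activations $\varphi_j:\mathbb{R}\to\mathbb{R}$, applied entrywise, that are $1$-Lipschitz and satisfy $\varphi_j(at)=a\varphi_j(t)$ for $a\ge0$; assume that every $r\in\mathcal{H}$ takes values in $I_r$ on $\mathcal{X}^{\mathrm{de}}$. Risks. Let $\mathbb{E}_{\mathrm{nu}},\mathbb{E}_{\mathrm{de}}$ be the expectations under $p_{\mathrm{nu}},p_{\mathrm{de}}$, and let $\hat{\mathbb{E}}_{\mathrm{nu}},\hat{\mathbb{E}}_{\mathrm{de}}$ be the averages over mutually independent i.i.d. samples of sizes $n_{\mathrm{nu}},n_{\mathrm{de}}\ge1$ from $p_{\mathrm{nu}},p_{\mathrm{de}}$. Put $$\mathrm{BR}_f(r)=\mathbb{E}_{\mathrm{de}}[f'(r(X))r(X)-f(r(X))]-\mathbb{E}_{\mathrm{nu}}[f'(r(X))],$$ $$\widehat{\mathrm{nnBR}}_f(r)=\hat{\mathbb{E}}_{\mathrm{nu}}[\ell_2(r(X))]+\max\{0,\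 \hat{\mathbb{E}}_{\mathrm{de}}[\ell_1(r(X))]-C\,\hat{\mathbb{E}}_{\mathrm{nu}}[\ell_1(r(X))]\}.$$ Let $\hat r$ be a minimizer of $\widehat{\mathrm{nnBR}}_f$ over $\mathcal{H}$ (the D3RE estimator) and $\bar r$ a minimizer of $\mathrm{BR}_f$ over $\mathcal{H}$, both assumed to exist. Assume $\inf_{r\in\mathcal{H}}(\mathbb{E}_{\mathrm{de}}-C\,\mathbb{E}_{\mathrm{nu}})[\ell_1(r(X))]>0$ and let $\alpha>0$ be any number not exceeding this infimum. Claim. There are constants $\kappa_1,\kappa_2$, depending only on $C$, $f$ (with its domain $I_r$), $B_p$, $L$ and $(B_{W_j})_{j=1}^L$, such that for every $\delta\in(0,1)$, with probability at least $1-\delta$, $$\mathrm{BR}_f(\hat r)-\mathrm{BR}_f(\bar r)\le\frac{\kappa_1}{\sqrt{n_{\mathrm{de}}}}+\frac{\kappa_2}{\sqrt{n_{\mathrm{nu}}}}+2\Phi+B_\ell\sqrt{8\Big(\frac1{n_{\mathrm{de}}}+\frac{(1+C)^2}{n_{\mathrm{nu}}}\Big)\log\frac1\delta},$$ where $$\Phi=(1+C)B_\ell\exp\!\Big(-\frac{2\alpha^2}{B_\ell^2/n_{\mathrm{de}}+C^2B_\ell^2/n_{\mathrm{nu}}}\Big).$$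 -/

import Mathlib

open MeasureTheory

noncomputable section

namespace D3RE

/-- The covariate space `ℝ^d` with its Euclidean norm. -/
abbrev Cov (d : ℕ) : Type := EuclideanSpace ℝ (Fin d)

/-! ### Probability densities and the density ratio -/

/-- `p` is a probability density on `ℝ^d` with respect to Lebesgue measure. -/
structure IsDensity {d : ℕ} (p : Cov d → ℝ) : Prop where
  measurable : Measurable p
  nonneg : ∀ x, 0 ≤ p x
  lintegral_eq_one : ∫⁻ x, ENNReal.ofReal (p x) = 1

/-- The distribution with density `p`. -/
def law {d : ℕ} (p : Cov d → ℝ) : Measure (Cov d) :=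
  volume.withDensity fun x => ENNReal.ofReal (p x)

/-- The domain of a density: the set where it is strictly positive. -/
def domain {d : ℕ} (p : Cov d → ℝ) : Set (Cov d) := {x | 0 < p x}

/-- The set of values of the density ratio `r^* = p_nu / p_de` on the domain of `p_de`. -/
def ratioValues {d : ℕ} (pnu pde : Cov d → ℝ) : Set ℝ :=
  (fun x => pnu x / pde x) '' domain pde

/-- `R̄`, the supremum of the density ratio. -/
def ratioSup {d : ℕ} (pnu pde : Cov d → ℝ) : ℝ := sSup (ratioValues pnu pde)

/-! ### Losses derived from the generator `f` of the Bregman divergence -/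

/-- `ℓ₁(t) = f'(t) t - f(t)`. -/
def loss1 (f : ℝ → ℝ) (t : ℝ) : ℝ := deriv f t * t - f t

/-- `f̃`, determined by `f'(t) = C (f'(t) t - f(t)) + f̃(t)`. -/
def fTilde (C : ℝ) (f : ℝ → ℝ) (t : ℝ) : ℝ := deriv f t - C * (deriv f t * t - f t)

/-- `ℓ₂(t) = - f̃(t)`. -/
def loss2 (C : ℝ) (f : ℝ → ℝ) (t : ℝ) : ℝ := -fTilde C f t

/-- The values of `max {|ℓ₁|, |ℓ₂|}` on the interval `I_r = (b_r, B_r)`. -/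
def lossValues (C : ℝ) (f : ℝ → ℝ) (br Br : ℝ) : Set ℝ :=
  (fun t => max |loss1 f t| |loss2 C f t|) '' Set.Ioo br Br

/-- `B_ℓ`, the supremum of `max {|ℓ₁|, |ℓ₂|}` on `I_r`. -/
def lossBound (C : ℝ) (f : ℝ → ℝ) (br Br : ℝ) : ℝ := sSup (lossValues C f br Br)

/-! ### Population and empirical risks -/

/-- The population risk
`BR_f(r) = E_de[f'(r(X)) r(X) - f(r(X))] - E_nu[f'(r(X))]`. -/
def BR {d : ℕ} (f : ℝ → ℝ) (pnu pde : Cov d → ℝ) (r : Cov d → ℝ) : ℝ :=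
  (∫ x, (deriv f (r x) * r x - f (r x)) ∂(law pde)) - ∫ x, deriv f (r x) ∂(law pnu)

/-- `(E_de - C E_nu) ℓ₁(r(X))`. -/
def modRisk {d : ℕ} (C : ℝ) (f : ℝ → ℝ) (pnu pde : Cov d → ℝ) (r : Cov d → ℝ) : ℝ :=
  (∫ x, loss1 f (r x) ∂(law pde)) - C * ∫ x, loss1 f (r x) ∂(law pnu)

/-- The average of `g` over a sample. -/
def sampleAvg {d n : ℕ} (S : Fin n → Cov d) (g : Cov d → ℝ) : ℝ := (∑ i, g (S i)) / n

/-- A pair of samples: the numerator sample and the denominator sample. -/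
abbrev Samples (d nnu nde : ℕ) : Type := (Fin nnu → Cov d) × (Fin nde → Cov d)

/-- The joint distribution of the two independent i.i.d. samples. -/
def sampleLaw {d : ℕ} (nnu nde : ℕ) (pnu pde : Cov d → ℝ) : Measure (Samples d nnu nde) :=
  (Measure.pi fun _ : Fin nnu => law pnu).prod (Measure.pi fun _ : Fin nde => law pde)

/-- The non-negative empirical risk
`Ê_nu[ℓ₂(r(X))] + (Ê_de[ℓ₁(r(X))] - C Ê_nu[ℓ₁(r(X))])₊`. -/
def nnBR {d nnu nde : ℕ} (C : ℝ) (f : ℝ → ℝ) (S : Samples d nnu nde) (r : Cov d → ℝ) : ℝ :=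
  sampleAvg S.1 (fun x => loss2 C f (r x)) +
    max 0 (sampleAvg S.2 (fun x => loss1 f (r x)) - C * sampleAvg S.1 (fun x => loss1 f (r x)))

/-- `r` minimizes `risk` over the hypothesis class `H`. -/
def IsMinimizer {d : ℕ} (risk : (Cov d → ℝ) → ℝ) (H : Set (Cov d → ℝ)) (r : Cov d → ℝ) : Prop :=
  r ∈ H ∧ IsMinOn risk H r

/-- The bias term `Φ = (1 + C) B_ℓ exp(-2 α² / (B_ℓ² / n_de + C² B_ℓ² / n_nu))`. -/
def biasTerm (C B α : ℝ) (nnu nde : ℕ) : ℝ :=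
  (1 + C) * B * Real.exp (-(2 * α ^ 2) / (B ^ 2 / nde + C ^ 2 * B ^ 2 / nnu))

/-! ### Neural networks -/

/-- `φ` is `1`-Lipschitz and positive-homogeneous. -/
structure IsActivation (φ : ℝ → ℝ) : Prop where
  lipschitz : LipschitzWith 1 φ
  homogeneous : ∀ a t : ℝ, 0 ≤ a → φ (a * t) = a * φ t

section

attribute [local instance] Matrix.frobeniusNormedAddCommGroup

/-- The maps `ℝ^d → ℝ^m` of the form
`x ↦ W_{k+1} φ_k(W_k φ_{k-1}(⋯ φ_1(W_1 x)))`, with arbitrary hidden widths, activations applied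
entrywise and Frobenius norms `‖W_j‖ ≤ BW j` for `1 ≤ j ≤ k + 1`. -/
def layerMaps (d : ℕ) (φ : ℕ → ℝ → ℝ) (BW : ℕ → ℝ) :
    ℕ → (m : ℕ) → Set (Cov d → Fin m → ℝ)
  | 0, m => {g | ∃ W : Matrix (Fin m) (Fin d) ℝ, ‖W‖ ≤ BW 1 ∧
      ∀ x, g x = W.mulVec fun i => x i}
  | k + 1, m => {g | ∃ m' : ℕ, ∃ h ∈ layerMaps d φ BW k m',
      ∃ W : Matrix (Fin m) (Fin m') ℝ, ‖W‖ ≤ BW (k + 2) ∧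
        ∀ x, g x = W.mulVec fun i => φ (k + 1) (h x i)}

end

/-- The real-valued networks `x ↦ W_L φ_{L-1}(W_{L-1} ⋯ φ_1(W_1 x))` of depth `L ≥ 1`, with
Frobenius norms `‖W_j‖ ≤ BW j` for `1 ≤ j ≤ L`. -/
def networks (d : ℕ) (φ : ℕ → ℝ → ℝ) (BW : ℕ → ℝ) (L : ℕ) : Set (Cov d → ℝ) :=
  {r | ∃ g ∈ layerMaps d φ BW (L - 1) 1, ∀ x, r x = g x 0}

end D3RE

end

/-!
Let `L_S(r)` be the empirical risk without truncation at zero, which is linear in the losses. It is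
at most `nnBR_S(r)`, so for an empirical minimizer `r̂` and a competitor `r̄`
`BR(r̂) - BR(r̄) ≤ sup_r (BR(r) - L_S(r)) + (nnBR_S(r̄) - BR(r̄))`.
The supremum splits into the one-sided deviations (`supDev`) of two linear empirical processes, one
for each sample. The right-hand side is thus a function of the two samples that changes by at most
`4 B_ℓ / n_de` or `4 (1 + C) B_ℓ / n_nu` with a single point, and McDiarmid's inequality
(`hasSubgaussianMGF_two_samples`, by tensorizing Hoeffding's lemma) replaces it by its mean, at the
cost of the term with `log (1 / δ)`.

The mean has two parts. That of `nnBR_S(r̄) - BR(r̄)` is the bias of the truncation, which acts only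
where `(Ê_de - C Ê_nu) ℓ₁(r̄)` falls short of its mean by at least `α`; McDiarmid's inequality again
makes this exponentially unlikely (`integral_empNonneg_le`). That of the deviations is at most twice
the Rademacher complexity (`integral_supDev_le`). The contraction principle (`contraction`) removes
the Lipschitz loss, and the network is peeled layer by layer (`sum_norm_feature_le`): by positive
homogeneity only a single normalized row of each weight matrix matters, so every layer costs the
factor `2 ‖W_j‖_F`, whatever its width, and the constants do not depend on the dimension.

Suprema inside Rademacher averages are expressed through selections, functions that assign a member
of the class to each sign vector; no boundedness or measurability has to be checked there. The
suprema under an integral run over a countable uniformly dense subfamily of the class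
(`exists_dense_seq`). Losses are extended off the interval and set to zero off the domain of the
denominator density (`truncLoss`), which the samples almost surely do not leave.
-/

noncomputable section

namespace D3RE

/-! ### Rademacher sums and the contraction principle -/

/-- The sign `±1` encoded by a Boolean. -/
def sgn (b : Bool) : ℝ := if b then 1 else -1

lemma sgn_not (b : Bool) : sgn (!b) = -sgn b := by cases b <;> simp [sgn]

lemma sgn_mul_self (b : Bool) : sgn b * sgn b = 1 := by cases b <;> simp [sgn]

lemma abs_sgn (b : Bool) : |sgn b| = 1 := by cases b <;> simp [sgn]

section Contraction

variable {ι : Type*} [DecidableEq ι]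

/-- Flipping the sign at one coordinate. -/
def flipAt (i : ι) (ε : ι → Bool) : ι → Bool := Function.update ε i (!ε i)

lemma flipAt_self (i : ι) (ε : ι → Bool) : flipAt i ε i = !ε i := by simp [flipAt]

lemma flipAt_of_ne {i j : ι} (h : j ≠ i) (ε : ι → Bool) : flipAt i ε j = ε j := by
  simp [flipAt, h]

lemma flipAt_involutive (i : ι) : Function.Involutive (flipAt i) := by
  intro ε
  funext j
  by_cases h : j = i
  · subst h; simp [flipAt]
  · simp [flipAt, h]

variable [Fintype ι]

lemma sum_flipAt (i : ι) (h : (ι → Bool) → ℝ) : ∑ ε, h (flipAt i ε) = ∑ ε, h ε :=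
  Equiv.sum_comp (flipAt_involutive i).toPerm h

/-- One coordinate of the contraction principle: in each pair of sign vectors that differ only at
`i`, the choice `τ` is either kept or swapped, whichever makes the contribution of `q` larger. -/
lemma contraction_coord {α : Type*} (i : ι) (A : (ι → Bool) → α → ℝ)
    (hA : ∀ ε a, A (flipAt i ε) a = A ε a) (p q : α → ℝ)
    (hpq : ∀ a b, |p a - p b| ≤ |q a - q b|) (τ : (ι → Bool) → α) :
    ∃ τ' : (ι → Bool) → α, ∑ ε, (A ε (τ ε) + sgn (ε i) * p (τ ε)) ≤
      ∑ ε, (A ε (τ' ε) + sgn (ε i) * q (τ' ε)) := by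
  classical
  let keep : (ι → Bool) → Prop := fun ε =>
    0 ≤ sgn (ε i) * (q (τ ε) - q (τ (flipAt i ε)))
  have hkeep : ∀ ε, keep (flipAt i ε) ↔ keep ε := by
    intro ε
    simp only [keep, flipAt_self, sgn_not, flipAt_involutive i ε]
    rw [show -sgn (ε i) * (q (τ (flipAt i ε)) - q (τ ε)) =
      sgn (ε i) * (q (τ ε) - q (τ (flipAt i ε))) by ring]
  refine ⟨fun ε => if keep ε then τ ε else τ (flipAt i ε), ?_⟩
  set τ' : (ι → Bool) → α := fun ε => if keep ε then τ ε else τ (flipAt i ε) with hτ'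
  -- Summing over pairs counts every sign vector twice.
  have double : ∀ h : (ι → Bool) → ℝ, 2 * ∑ ε, h ε = ∑ ε, (h ε + h (flipAt i ε)) := by
    intro h
    rw [Finset.sum_add_distrib, sum_flipAt, two_mul]
  refine le_of_mul_le_mul_left ?_ (zero_lt_two' ℝ)
  rw [double, double]
  refine Finset.sum_le_sum fun ε _ => ?_
  have hs : |sgn (ε i) * (p (τ ε) - p (τ (flipAt i ε)))| ≤
      |sgn (ε i) * (q (τ ε) - q (τ (flipAt i ε)))| := by
    rw [abs_mul, abs_mul, abs_sgn, one_mul, one_mul]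
    exact hpq _ _
  simp only [hA, flipAt_self, sgn_not]
  by_cases hk : keep ε
  · have h1 : τ' ε = τ ε := if_pos hk
    have h2 : τ' (flipAt i ε) = τ (flipAt i ε) := if_pos ((hkeep ε).2 hk)
    rw [h1, h2]
    rw [abs_of_nonneg hk] at hs
    linarith [le_abs_self (sgn (ε i) * (p (τ ε) - p (τ (flipAt i ε))))]
  · have h1 : τ' ε = τ (flipAt i ε) := if_neg hk
    have h2 : τ' (flipAt i ε) = τ ε := by
      rw [hτ']
      simp only [hkeep, hk, if_false, flipAt_involutive i ε]
    rw [h1, h2]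
    rw [abs_of_neg (not_le.1 hk)] at hs
    linarith [le_abs_self (sgn (ε i) * (p (τ ε) - p (τ (flipAt i ε))))]

/-- The contraction principle for Rademacher sums. The supremum over a class is expressed by
functions `τ` that pick a member of the class for each sign vector, so that no boundedness is
needed. -/
theorem contraction {α : Type*} (p q : ι → α → ℝ)
    (hpq : ∀ i a b, |p i a - p i b| ≤ |q i a - q i b|) (τ : (ι → Bool) → α) :
    ∃ τ' : (ι → Bool) → α, ∑ ε, ∑ i, sgn (ε i) * p i (τ ε) ≤
      ∑ ε, ∑ i, sgn (ε i) * q i (τ' ε) := by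
  suffices H : ∀ s : Finset ι, ∃ τ' : (ι → Bool) → α, ∑ ε, ∑ i, sgn (ε i) * p i (τ ε) ≤
      ∑ ε, ∑ i, sgn (ε i) * (if i ∈ s then q i else p i) (τ' ε) by
    simpa using H Finset.univ
  intro s
  induction s using Finset.induction_on with
  | empty => exact ⟨τ, by simp⟩
  | insert i s hi ih =>
    obtain ⟨τ₁, h₁⟩ := ih
    obtain ⟨τ₂, h₂⟩ := contraction_coord i
      (fun ε a => ∑ j ∈ Finset.univ.erase i, sgn (ε j) * (if j ∈ s then q j else p j) a)
      (fun ε a => Finset.sum_congr rfl fun j hj => by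
        rw [flipAt_of_ne (Finset.ne_of_mem_erase hj)]) (p i) (q i) (hpq i) τ₁
    refine ⟨τ₂, h₁.trans (le_of_eq_of_le ?_ (h₂.trans_eq ?_))⟩
    · refine Finset.sum_congr rfl fun ε _ => ?_
      rw [← Finset.sum_erase_add _ _ (Finset.mem_univ i), if_neg hi]
    · refine Finset.sum_congr rfl fun ε _ => ?_
      rw [← Finset.sum_erase_add _ _ (Finset.mem_univ i), if_pos (Finset.mem_insert_self i s)]
      congr 1
      refine Finset.sum_congr rfl fun j hj => ?_
      simp [Finset.mem_insert, Finset.ne_of_mem_erase hj]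


lemma sum_sgn_mul_sgn {i j : ι} (h : i ≠ j) : ∑ ε : ι → Bool, sgn (ε i) * sgn (ε j) = 0 := by
  have := sum_flipAt i fun ε : ι → Bool => sgn (ε i) * sgn (ε j)
  simp only [flipAt_self, flipAt_of_ne h.symm, sgn_not, neg_mul, Finset.sum_neg_distrib] at this
  linarith

/-- The mean norm of a Rademacher sum of vectors, by orthogonality of the signs. -/
lemma sum_norm_rademacher_le {E : Type*} [NormedAddCommGroup E] [InnerProductSpace ℝ E]
    (x : ι → E) :
    ∑ ε : ι → Bool, ‖∑ i, sgn (ε i) • x i‖ ≤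
      Fintype.card (ι → Bool) * Real.sqrt (∑ i, ‖x i‖ ^ 2) := by
  have hsq : ∑ ε : ι → Bool, ‖∑ i, sgn (ε i) • x i‖ ^ 2 =
      Fintype.card (ι → Bool) * ∑ i, ‖x i‖ ^ 2 := by
    have : ∀ ε : ι → Bool, ‖∑ i, sgn (ε i) • x i‖ ^ 2 =
        ∑ i, ∑ j, sgn (ε i) * sgn (ε j) * inner ℝ (x i) (x j) := by
      intro ε
      rw [← real_inner_self_eq_norm_sq, sum_inner]
      refine Finset.sum_congr rfl fun i _ => ?_
      rw [inner_sum]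
      refine Finset.sum_congr rfl fun j _ => ?_
      rw [real_inner_smul_left, real_inner_smul_right]
      ring
    simp only [this]
    rw [Finset.sum_comm, Finset.mul_sum]
    refine Finset.sum_congr rfl fun i _ => ?_
    rw [Finset.sum_comm, Finset.sum_eq_single i]
    · simp [sgn_mul_self]
    · intro j _ hj
      rw [← Finset.sum_mul, sum_sgn_mul_sgn hj.symm, zero_mul]
    · simp
  refine le_of_sq_le_sq ?_ (by positivity)
  calc (∑ ε : ι → Bool, ‖∑ i, sgn (ε i) • x i‖) ^ 2
      ≤ Fintype.card (ι → Bool) * ∑ ε : ι → Bool, ‖∑ i, sgn (ε i) • x i‖ ^ 2 := by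
        simpa using sq_sum_le_card_mul_sum_sq (s := (Finset.univ : Finset (ι → Bool)))
          (f := fun ε => ‖∑ i, sgn (ε i) • x i‖)
    _ = (Fintype.card (ι → Bool) * Real.sqrt (∑ i, ‖x i‖ ^ 2)) ^ 2 := by
        rw [hsq, mul_pow, Real.sq_sqrt (by positivity)]
        ring

end Contraction

/-! ### Rademacher complexity of norm-bounded networks -/

section Networks

attribute [local instance] Matrix.frobeniusNormedAddCommGroup

variable {ι : Type*} [Fintype ι]

lemma IsActivation.map_zero {φ : ℝ → ℝ} (h : IsActivation φ) : φ 0 = 0 := by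
  simpa using h.homogeneous 0 0 le_rfl

lemma IsActivation.abs_sub_le {φ : ℝ → ℝ} (h : IsActivation φ) (a b : ℝ) :
    |φ a - φ b| ≤ |a - b| := by
  simpa [Real.dist_eq] using h.lipschitz.dist_le_mul a b

/-- Reversing all signs permutes the sign vectors. -/
lemma sum_not (h : (ι → Bool) → ℝ) [DecidableEq ι] : ∑ ε : ι → Bool, h (fun i => !ε i) = ∑ ε, h ε :=
  Equiv.sum_comp (Function.Involutive.toPerm (fun (ε : ι → Bool) i => !ε i)
    fun ε => by funext i; simp) h

/-- Contraction for absolute values of Rademacher sums. Both signs of the sum have to be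
controlled, which costs the factor `2`. -/
lemma sum_abs_activation_le [DecidableEq ι] {φ : ℝ → ℝ} (hφ : IsActivation φ) {T : Set (ι → ℝ)}
    (h0 : (0 : ι → ℝ) ∈ T) {b : ℝ}
    (hb : ∀ τ : (ι → Bool) → T, ∑ ε, ∑ i, sgn (ε i) * (τ ε : ι → ℝ) i ≤ b)
    (τ : (ι → Bool) → T) :
    ∑ ε, |∑ i, sgn (ε i) * φ ((τ ε : ι → ℝ) i)| ≤ 2 * b := by
  classical
  have key : ∀ τ : (ι → Bool) → T,
      ∑ ε, max 0 (∑ i, sgn (ε i) * φ ((τ ε : ι → ℝ) i)) ≤ b := by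
    intro τ
    let σ : (ι → Bool) → T := fun ε =>
      if 0 ≤ ∑ i, sgn (ε i) * φ ((τ ε : ι → ℝ) i) then τ ε else ⟨0, h0⟩
    obtain ⟨σ', hσ'⟩ := contraction (fun i (t : T) => φ ((t : ι → ℝ) i))
      (fun i (t : T) => (t : ι → ℝ) i) (fun i a b => hφ.abs_sub_le _ _) σ
    refine le_of_eq_of_le (Finset.sum_congr rfl fun ε _ => ?_) (hσ'.trans (hb σ'))
    by_cases h : 0 ≤ ∑ i, sgn (ε i) * φ ((τ ε : ι → ℝ) i)
    · simp only [σ, if_pos h, max_eq_right h]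
    · simp only [σ, if_neg h, max_eq_left (not_le.1 h).le, Pi.zero_apply, hφ.map_zero, mul_zero,
        Finset.sum_const_zero]
  have hneg := key fun ε => τ fun i => !ε i
  rw [← sum_not] at hneg
  simp only [sgn_not, Bool.not_not, neg_mul, Finset.sum_neg_distrib] at hneg
  calc ∑ ε, |∑ i, sgn (ε i) * φ ((τ ε : ι → ℝ) i)|
      = ∑ ε, (max 0 (∑ i, sgn (ε i) * φ ((τ ε : ι → ℝ) i)) +
          max 0 (-∑ i, sgn (ε i) * φ ((τ ε : ι → ℝ) i))) := by
        refine Finset.sum_congr rfl fun ε _ => ?_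
        rcases le_total 0 (∑ i, sgn (ε i) * φ ((τ ε : ι → ℝ) i)) with h | h
        · rw [abs_of_nonneg h, max_eq_right h, max_eq_left (by linarith), add_zero]
        · rw [abs_of_nonpos h, max_eq_left h, max_eq_right (by linarith), zero_add]
    _ ≤ 2 * b := by
        rw [Finset.sum_add_distrib]
        linarith [key τ]

/-- A row of a matrix as a vector of the Euclidean space. -/
def rowVec {m n : ℕ} (W : Matrix (Fin m) (Fin n) ℝ) (j : Fin m) : EuclideanSpace ℝ (Fin n) :=
  WithLp.toLp 2 (W j)

lemma mulVec_eq_inner {m n : ℕ} (W : Matrix (Fin m) (Fin n) ℝ) (v : EuclideanSpace ℝ (Fin n))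
    (j : Fin m) : W.mulVec (fun i => v i) j = inner ℝ (rowVec W j) v := by
  simp [Matrix.mulVec, dotProduct, PiLp.inner_apply, rowVec, mul_comm]

lemma frobenius_sq_eq_sum_rowVec {m n : ℕ} (W : Matrix (Fin m) (Fin n) ℝ) :
    ‖W‖ ^ 2 = ∑ j, ‖rowVec W j‖ ^ 2 := by
  rw [Matrix.frobenius_norm_def, ← Real.sqrt_eq_rpow, Real.sq_sqrt (by positivity)]
  simp [EuclideanSpace.norm_sq_eq, rowVec]

/-- Peeling one layer: by positive homogeneity the norm of each row of `W` can be pulled out of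
the activation, and the row with the largest normalized contribution dominates. -/
lemma exists_unit_row {m n : ℕ} {φ : ℝ → ℝ} (hφ : IsActivation φ) (W : Matrix (Fin m) (Fin n) ℝ)
    (σ : ι → ℝ) (v : ι → EuclideanSpace ℝ (Fin n)) :
    ∃ w : EuclideanSpace ℝ (Fin n), ‖w‖ ≤ 1 ∧
      ‖∑ i, σ i • (WithLp.toLp 2 fun j => φ (W.mulVec (fun l => v i l) j) :
        EuclideanSpace ℝ (Fin m))‖ ≤ ‖W‖ * |∑ i, σ i * φ (inner ℝ w (v i))| := by
  classical
  rcases isEmpty_or_nonempty (Fin m) with hm | hm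
  · refine ⟨0, by simp, ?_⟩
    rw [Subsingleton.elim (∑ i, σ i • (WithLp.toLp 2 fun j => φ (W.mulVec (fun l => v i l) j) :
        EuclideanSpace ℝ (Fin m))) 0, norm_zero]
    positivity
  let u : Fin m → EuclideanSpace ℝ (Fin n) := fun j => ‖rowVec W j‖⁻¹ • rowVec W j
  have hu : ∀ j, ‖u j‖ ≤ 1 := fun j => by
    simp only [u, norm_smul, norm_inv, norm_norm]
    exact inv_mul_le_one
  have hrow : ∀ j, rowVec W j = ‖rowVec W j‖ • u j := fun j => by
    by_cases h : ‖rowVec W j‖ = 0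
    · rw [h, zero_smul]; exact norm_eq_zero.1 h
    · simp only [u, smul_smul, mul_inv_cancel₀ h, one_smul]
  let a : Fin m → ℝ := fun j => |∑ i, σ i * φ (inner ℝ (u j) (v i))|
  obtain ⟨j₀, hj₀⟩ := Finite.exists_max a
  refine ⟨u j₀, hu j₀, ?_⟩
  refine le_of_sq_le_sq ?_ (by positivity)
  rw [EuclideanSpace.norm_sq_eq, mul_pow, frobenius_sq_eq_sum_rowVec, Finset.sum_mul]
  refine Finset.sum_le_sum fun j _ => ?_
  have : (∑ i, σ i • (WithLp.toLp 2 fun j => φ (W.mulVec (fun l => v i l) j) :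
        EuclideanSpace ℝ (Fin m))) j =
      ‖rowVec W j‖ * ∑ i, σ i * φ (inner ℝ (u j) (v i)) := by
    rw [WithLp.ofLp_sum, Finset.sum_apply, Finset.mul_sum]
    refine Finset.sum_congr rfl fun i _ => ?_
    simp only [PiLp.smul_apply, smul_eq_mul, mulVec_eq_inner]
    rw [hrow j, real_inner_smul_left, hφ.homogeneous _ _ (norm_nonneg _), ← hrow j]
    ring
  rw [this, norm_mul, norm_norm, mul_pow]
  gcongr
  exact hj₀ j

/-- `IsFeature d φ BW k m z`: the map `z : ℝ^d → ℝ^m` is the output of `k` hidden layers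
`x ↦ φ_k(W_k ⋯ φ_1(W_1 x))` with Frobenius norms `‖W_j‖ ≤ BW j`. -/
inductive IsFeature (d : ℕ) (φ : ℕ → ℝ → ℝ) (BW : ℕ → ℝ) :
    ℕ → (m : ℕ) → (Cov d → EuclideanSpace ℝ (Fin m)) → Prop
  | input : IsFeature d φ BW 0 d fun x => x
  | layer {k m' m : ℕ} {z : Cov d → EuclideanSpace ℝ (Fin m')} (W : Matrix (Fin m) (Fin m') ℝ)
      (hz : IsFeature d φ BW k m' z) (hW : ‖W‖ ≤ BW (k + 1)) :
      IsFeature d φ BW (k + 1) m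
        fun x => WithLp.toLp 2 fun j => φ (k + 1) (W.mulVec (fun l => z x l) j)

variable {d : ℕ} {φ : ℕ → ℝ → ℝ} {BW : ℕ → ℝ}

lemma IsFeature.exists_layer {k m : ℕ} {z : Cov d → EuclideanSpace ℝ (Fin m)}
    (hz : IsFeature d φ BW (k + 1) m z) :
    ∃ (m' : ℕ) (z' : Cov d → EuclideanSpace ℝ (Fin m')) (W : Matrix (Fin m) (Fin m') ℝ),
      IsFeature d φ BW k m' z' ∧ ‖W‖ ≤ BW (k + 1) ∧
        z = fun x => WithLp.toLp 2 fun j => φ (k + 1) (W.mulVec (fun l => z' x l) j) := by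
  cases hz with
  | layer W hz hW => exact ⟨_, _, W, hz, hW, rfl⟩

lemma IsFeature.norm_sum_input {m : ℕ} {z : Cov d → EuclideanSpace ℝ (Fin m)}
    (hz : IsFeature d φ BW 0 m z) (σ : ι → ℝ) (x : ι → Cov d) :
    ‖∑ i, σ i • z (x i)‖ = ‖∑ i, σ i • x i‖ := by
  cases hz
  rfl

lemma exists_feature_of_mem_layerMaps {k m : ℕ} {g : Cov d → Fin m → ℝ}
    (hg : g ∈ layerMaps d φ BW k m) :
    ∃ (m' : ℕ) (z : Cov d → EuclideanSpace ℝ (Fin m')) (W : Matrix (Fin m) (Fin m') ℝ),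
      IsFeature d φ BW k m' z ∧ ‖W‖ ≤ BW (k + 1) ∧ ∀ x, g x = W.mulVec fun l => z x l := by
  induction k generalizing m with
  | zero =>
    obtain ⟨W, hW, hg⟩ := hg
    exact ⟨d, _, W, .input, hW, hg⟩
  | succ k ih =>
    obtain ⟨m', h, hh, W, hW, hg⟩ := hg
    obtain ⟨m'', z, W', hz, hW', hh'⟩ := ih hh
    refine ⟨m', _, W, .layer W' hz hW', hW, fun x => ?_⟩
    rw [hg x, hh' x]

/-- A network is a bounded linear functional of its last hidden layer. -/
lemma exists_feature_of_mem_networks {L : ℕ} (hL : 1 ≤ L) {r : Cov d → ℝ}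
    (hr : r ∈ networks d φ BW L) :
    ∃ (m : ℕ) (z : Cov d → EuclideanSpace ℝ (Fin m)) (w : EuclideanSpace ℝ (Fin m)),
      IsFeature d φ BW (L - 1) m z ∧ ‖w‖ ≤ BW L ∧ ∀ x, r x = inner ℝ w (z x) := by
  obtain ⟨g, hg, hr⟩ := hr
  obtain ⟨m, z, W, hz, hW, hg⟩ := exists_feature_of_mem_layerMaps hg
  rw [Nat.sub_add_cancel hL] at hW
  refine ⟨m, z, rowVec W 0, hz, ?_, fun x => ?_⟩
  · refine (le_of_sq_le_sq ?_ (norm_nonneg W)).trans hW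
    rw [frobenius_sq_eq_sum_rowVec]
    simp
  · rw [hr, hg, mulVec_eq_inner]

lemma IsFeature.continuous {k m : ℕ} {z : Cov d → EuclideanSpace ℝ (Fin m)}
    (hz : IsFeature d φ BW k m z) (hφ : ∀ j ∈ Finset.Icc 1 k, IsActivation (φ j)) :
    Continuous z := by
  induction hz with
  | input => exact continuous_id
  | @layer k m' m z W hz hW ih =>
    have hz' := ih fun j hj => hφ j (by simp only [Finset.mem_Icc] at hj ⊢; omega)
    have hc := (hφ (k + 1) (by simp)).lipschitz.continuous
    refine (PiLp.continuous_toLp 2 _).comp (continuous_pi fun j => ?_)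
    simp only [mulVec_eq_inner]
    exact hc.comp (continuous_const.inner hz')

lemma continuous_of_mem_networks {L : ℕ} (hL : 1 ≤ L)
    (hφ : ∀ j ∈ Finset.Ico 1 L, IsActivation (φ j)) {r : Cov d → ℝ}
    (hr : r ∈ networks d φ BW L) : Continuous r := by
  obtain ⟨m, z, w, hz, -, hr⟩ := exists_feature_of_mem_networks hL hr
  rw [funext hr]
  exact continuous_const.inner (hz.continuous fun j hj => hφ j (by
    simp only [Finset.mem_Icc, Finset.mem_Ico] at hj ⊢; omega))

/-- The Rademacher complexity of the hidden features at depth `k`: each layer contributes the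
factor `2 ‖W_j‖`, independently of the widths. -/
lemma sum_norm_feature_le [DecidableEq ι] {R : ℝ} (hR : 0 ≤ R) {x : ι → Cov d}
    (hx : ∀ i, ‖x i‖ ≤ R) (k : ℕ) (hφ : ∀ j ∈ Finset.Icc 1 k, IsActivation (φ j))
    (hBW : ∀ j ∈ Finset.Icc 1 k, 0 ≤ BW j)
    (m : (ι → Bool) → ℕ) (z : ∀ ε, Cov d → EuclideanSpace ℝ (Fin (m ε)))
    (hz : ∀ ε, IsFeature d φ BW k (m ε) (z ε)) :
    ∑ ε, ‖∑ i, sgn (ε i) • z ε (x i)‖ ≤ Fintype.card (ι → Bool) *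
      (2 ^ k * (∏ j ∈ Finset.Icc 1 k, BW j) * (R * Real.sqrt (Fintype.card ι))) := by
  induction k generalizing m z with
  | zero =>
    have : ∀ ε : ι → Bool, ‖∑ i, sgn (ε i) • z ε (x i)‖ = ‖∑ i, sgn (ε i) • x i‖ := by
      exact fun ε => (hz ε).norm_sum_input _ x
    simp only [this]
    refine (sum_norm_rademacher_le x).trans ?_
    simp only [pow_zero, Finset.Icc_eq_empty_of_lt Nat.zero_lt_one, Finset.prod_empty, one_mul]
    gcongr
    rw [← Real.sqrt_sq hR, ← Real.sqrt_mul (by positivity)]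
    gcongr
    refine (Finset.sum_le_card_nsmul _ _ (R ^ 2) fun i _ => ?_).trans_eq ?_
    · have := hx i
      gcongr
    · simp [mul_comm]
  | succ k ih =>
    have hφk : ∀ j ∈ Finset.Icc 1 k, IsActivation (φ j) := fun j hj =>
      hφ j (by simp only [Finset.mem_Icc] at hj ⊢; omega)
    have hBWk : ∀ j ∈ Finset.Icc 1 k, 0 ≤ BW j := fun j hj =>
      hBW j (by simp only [Finset.mem_Icc] at hj ⊢; omega)
    have hφ₁ : IsActivation (φ (k + 1)) := hφ _ (by simp)
    have hBW₁ : 0 ≤ BW (k + 1) := hBW _ (by simp)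
    choose m' z' W hz' hW hzW using fun ε => (hz ε).exists_layer
    choose w hw hwle using fun ε =>
      exists_unit_row hφ₁ (W ε) (fun i => sgn (ε i)) fun i => z' ε (x i)
    let T : Set (ι → ℝ) := {t | ∃ (m : ℕ) (z : Cov d → EuclideanSpace ℝ (Fin m))
      (w : EuclideanSpace ℝ (Fin m)), IsFeature d φ BW k m z ∧ ‖w‖ ≤ 1 ∧
        t = fun i => inner ℝ w (z (x i))}
    have hT0 : (0 : ι → ℝ) ∈ T :=
      ⟨_, _, 0, hz' fun _ => true, by simp, by funext i; simp⟩
    have habs := sum_abs_activation_le hφ₁ hT0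
      (b := Fintype.card (ι → Bool) *
        (2 ^ k * (∏ j ∈ Finset.Icc 1 k, BW j) * (R * Real.sqrt (Fintype.card ι)))) (by
      intro τ
      choose m₁ z₁ w₁ hz₁ hw₁ ht using fun ε => (τ ε).2
      refine le_trans (Finset.sum_le_sum fun ε _ => ?_) (ih hφk hBWk m₁ z₁ hz₁)
      calc ∑ i, sgn (ε i) * (τ ε : ι → ℝ) i
          = inner ℝ (w₁ ε) (∑ i, sgn (ε i) • z₁ ε (x i)) := by
            simp only [inner_sum, real_inner_smul_right, ht ε]
        _ ≤ ‖w₁ ε‖ * ‖∑ i, sgn (ε i) • z₁ ε (x i)‖ := real_inner_le_norm _ _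
        _ ≤ ‖∑ i, sgn (ε i) • z₁ ε (x i)‖ :=
            mul_le_of_le_one_left (norm_nonneg _) (hw₁ ε))
      (fun ε => ⟨fun i => inner ℝ (w ε) (z' ε (x i)), _, _, _, hz' ε, hw ε, rfl⟩)
    calc ∑ ε, ‖∑ i, sgn (ε i) • z ε (x i)‖
        ≤ ∑ ε : ι → Bool, BW (k + 1) *
            |∑ i, sgn (ε i) * φ (k + 1) (inner ℝ (w ε) (z' ε (x i)))| := by
          refine Finset.sum_le_sum fun ε _ => ?_
          rw [hzW ε]
          refine (hwle ε).trans ?_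
          gcongr
          exact hW ε
      _ ≤ _ := by
          rw [← Finset.mul_sum]
          refine (mul_le_mul_of_nonneg_left habs hBW₁).trans_eq ?_
          rw [Finset.prod_Icc_succ_top (by omega), pow_succ]
          ring

/-- The Rademacher complexity of Lipschitz transforms of networks, at points of norm at most
`R`. -/
theorem rademacher_networks_le [DecidableEq ι] {L : ℕ} (hL : 1 ≤ L) {R : ℝ} (hR : 0 ≤ R)
    {x : ι → Cov d} (hx : ∀ i, ‖x i‖ ≤ R) (hφ : ∀ j ∈ Finset.Ico 1 L, IsActivation (φ j))
    (hBW : ∀ j ∈ Finset.Icc 1 L, 0 ≤ BW j) {κ : Type*} {r : κ → Cov d → ℝ}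
    (hr : ∀ k, r k ∈ networks d φ BW L) {K : ℝ} (hK : 0 ≤ K) {g : κ → ι → ℝ}
    (hg : ∀ i k k', |g k i - g k' i| ≤ K * |r k (x i) - r k' (x i)|) (τ : (ι → Bool) → κ) :
    ∑ ε, ∑ i, sgn (ε i) * g (τ ε) i ≤ Fintype.card (ι → Bool) *
      (K * (2 ^ (L - 1) * (∏ j ∈ Finset.Icc 1 L, BW j) * R) * Real.sqrt (Fintype.card ι)) := by
  obtain ⟨τ', hτ'⟩ := contraction (fun i k => g k i) (fun i k => K * r k (x i))
    (fun i k k' => by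
      rw [← mul_sub, abs_mul, abs_of_nonneg hK]
      exact hg i k k') τ
  refine hτ'.trans ?_
  choose m z w hz hw hrz using fun k => exists_feature_of_mem_networks hL (hr k)
  have hBL : 0 ≤ BW L := hBW L (by simp [hL])
  have hmain := sum_norm_feature_le hR hx (L - 1)
    (fun j hj => hφ j (by simp only [Finset.mem_Icc, Finset.mem_Ico] at hj ⊢; omega))
    (fun j hj => hBW j (by simp only [Finset.mem_Icc] at hj ⊢; omega))
    (fun ε => m (τ' ε)) (fun ε => z (τ' ε)) fun ε => hz (τ' ε)
  calc ∑ ε, ∑ i, sgn (ε i) * (K * r (τ' ε) (x i))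
      ≤ ∑ ε : ι → Bool, K * BW L * ‖∑ i, sgn (ε i) • z (τ' ε) (x i)‖ := by
        refine Finset.sum_le_sum fun ε _ => ?_
        calc ∑ i, sgn (ε i) * (K * r (τ' ε) (x i))
            = K * inner ℝ (w (τ' ε)) (∑ i, sgn (ε i) • z (τ' ε) (x i)) := by
              simp only [inner_sum, real_inner_smul_right, hrz, Finset.mul_sum]
              exact Finset.sum_congr rfl fun i _ => by ring
          _ ≤ K * (BW L * ‖∑ i, sgn (ε i) • z (τ' ε) (x i)‖) := by
              gcongr
              refine (real_inner_le_norm _ _).trans ?_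
              gcongr
              exact hw _
          _ = _ := by ring
    _ ≤ _ := by
        rw [← Finset.mul_sum]
        refine (mul_le_mul_of_nonneg_left hmain (by positivity)).trans_eq ?_
        obtain ⟨l, rfl⟩ := Nat.exists_eq_add_of_le' hL
        rw [Finset.prod_Icc_succ_top (by omega)]
        simp only [Nat.add_sub_cancel]
        ring

end Networks

/-! ### McDiarmid's inequality -/

section McDiarmid

open ProbabilityTheory
open scoped NNReal

variable {X Y : Type*} [MeasurableSpace X] [MeasurableSpace Y]

lemma integrable_of_abs_le {μ : Measure X} [IsFiniteMeasure μ] {F : X → ℝ} (hF : Measurable F)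
    {M : ℝ} (hM : ∀ x, |F x| ≤ M) : Integrable F μ :=
  Integrable.of_bound hF.aestronglyMeasurable M (Filter.Eventually.of_forall hM)

lemma integrable_exp_mul_sub {μ : Measure X} [IsFiniteMeasure μ] {F : X → ℝ} (hF : Measurable F)
    {M : ℝ} (hM : ∀ x, |F x| ≤ M) (t a : ℝ) :
    Integrable (fun x => Real.exp (t * (F x - a))) μ := by
  refine integrable_of_abs_le (by fun_prop) (M := Real.exp (|t| * (M + |a|))) fun x => ?_
  rw [Real.abs_exp, Real.exp_le_exp]
  calc t * (F x - a) ≤ |t * (F x - a)| := le_abs_self _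
    _ = |t| * |F x - a| := abs_mul _ _
    _ ≤ |t| * (M + |a|) := by
      gcongr
      exact (abs_sub _ _).trans (by linarith [hM x])

lemma abs_integral_le_of_abs_le {μ : Measure X} [IsProbabilityMeasure μ] {F : X → ℝ} {M : ℝ}
    (hM : ∀ x, |F x| ≤ M) : |∫ x, F x ∂μ| ≤ M := by
  simpa using norm_integral_le_of_norm_le_const (μ := μ) (f := F)
    (Filter.Eventually.of_forall hM)

lemma abs_integral_sub_integral_le {μ : Measure X} [IsProbabilityMeasure μ] {F G : X → ℝ}
    (hF : Integrable F μ) (hG : Integrable G μ) {c : ℝ} (h : ∀ x, |F x - G x| ≤ c) :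
    |(∫ x, F x ∂μ) - ∫ x, G x ∂μ| ≤ c := by
  rw [← integral_sub hF hG]
  exact abs_integral_le_of_abs_le h

/-- Sub-Gaussian tensorization: the conditional variance proxy adds to that of the conditional
mean. -/
lemma hasSubgaussianMGF_prod {μ : Measure X} {ν : Measure Y} [IsProbabilityMeasure μ]
    [IsProbabilityMeasure ν] {F : X × Y → ℝ} (hF : Measurable F) {M : ℝ} (hM : ∀ p, |F p| ≤ M)
    {c₁ c₂ : ℝ≥0}
    (h₁ : ∀ x, HasSubgaussianMGF (fun y => F (x, y) - ∫ y', F (x, y') ∂ν) c₁ ν)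
    (h₂ : HasSubgaussianMGF (fun x => (∫ y, F (x, y) ∂ν) - ∫ x', ∫ y, F (x', y) ∂ν ∂μ) c₂ μ) :
    HasSubgaussianMGF (fun p => F p - ∫ p', F p' ∂(μ.prod ν)) (c₂ + c₁) (μ.prod ν) where
  integrable_exp_mul t := integrable_exp_mul_sub hF hM t _
  mgf_le t := by
    have hint := integrable_exp_mul_sub (μ := μ.prod ν) hF hM t (∫ p', F p' ∂(μ.prod ν))
    have hFubini := integral_prod F (integrable_of_abs_le (μ := μ.prod ν) hF hM)
    rw [mgf, integral_prod _ hint, hFubini]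
    set E := ∫ x', ∫ y, F (x', y) ∂ν ∂μ with hE
    calc ∫ x, ∫ y, Real.exp (t * (F (x, y) - E)) ∂ν ∂μ
        ≤ ∫ x, Real.exp (c₁ * t ^ 2 / 2) * Real.exp (t * ((∫ y, F (x, y) ∂ν) - E)) ∂μ := by
          refine integral_mono ?_ ((h₂.integrable_exp_mul t).const_mul _) fun x => ?_
          · rw [hFubini] at hint
            exact hint.integral_prod_left
          · have hx := (h₁ x).mgf_le t
            simp only [mgf] at hx
            calc ∫ y, Real.exp (t * (F (x, y) - E)) ∂ν
                = (∫ y, Real.exp (t * (F (x, y) - ∫ y', F (x, y') ∂ν)) ∂ν) *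
                    Real.exp (t * ((∫ y, F (x, y) ∂ν) - E)) := by
                  rw [← integral_mul_const]
                  refine integral_congr_ae (Filter.Eventually.of_forall fun y => ?_)
                  simp only [← Real.exp_add]
                  ring_nf
              _ ≤ _ := by gcongr
      _ ≤ Real.exp (c₁ * t ^ 2 / 2) * Real.exp (c₂ * t ^ 2 / 2) := by
          rw [integral_const_mul]
          gcongr
          exact h₂.mgf_le t
      _ = Real.exp ((c₂ + c₁ : ℝ≥0) * t ^ 2 / 2) := by
          rw [← Real.exp_add]
          push_cast
          ring_nf

/-- Hoeffding's lemma for a function of oscillation at most `c`. -/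
lemma hasSubgaussianMGF_of_abs_sub_le {μ : Measure X} [IsProbabilityMeasure μ] {F : X → ℝ}
    (hF : Measurable F) {c : ℝ≥0} (hc : ∀ x y, |F x - F y| ≤ c) :
    HasSubgaussianMGF (fun x => F x - ∫ x', F x' ∂μ) ((c / 2) ^ 2) μ := by
  obtain ⟨x₀⟩ : Nonempty X := nonempty_of_isProbabilityMeasure μ
  have hbdd : BddBelow (Set.range F) := ⟨F x₀ - c, by
    rintro _ ⟨x, rfl⟩
    linarith [le_abs_self (F x₀ - F x), hc x₀ x]⟩
  have hmem : ∀ x, F x ∈ Set.Icc (⨅ x, F x) ((⨅ x, F x) + c) := fun x => by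
    have : Nonempty X := ⟨x₀⟩
    refine ⟨ciInf_le hbdd x, ?_⟩
    have : F x - c ≤ ⨅ x, F x := le_ciInf fun y => by
      linarith [le_abs_self (F x - F y), hc x y]
    linarith
  have := hasSubgaussianMGF_of_mem_Icc hF.aemeasurable
    (Filter.Eventually.of_forall hmem : ∀ᵐ x ∂μ, _)
  simpa using this

/-- Changing one of the points changes the value of `F` by at most `c`. -/
def HasBoundedDiff {n : ℕ} (c : ℝ) (F : (Fin n → X) → ℝ) : Prop :=
  ∀ i x y, (∀ j, j ≠ i → x j = y j) → |F x - F y| ≤ c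

/-- McDiarmid's inequality, in the form of a bound on the moment generating function. -/
theorem hasSubgaussianMGF_pi {n : ℕ} {μ : Measure X} [IsProbabilityMeasure μ]
    {F : (Fin n → X) → ℝ} (hF : Measurable F) {M : ℝ} (hM : ∀ x, |F x| ≤ M) {c : ℝ≥0}
    (hc : HasBoundedDiff c F) :
    HasSubgaussianMGF (fun x => F x - ∫ x', F x' ∂(Measure.pi fun _ => μ)) (n * (c / 2) ^ 2)
      (Measure.pi fun _ => μ) := by
  induction n with
  | zero =>
    have : ∀ x, F x = F default := fun x => congrArg F (Subsingleton.elim _ _)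
    simp only [this]
    simp
  | succ n ih =>
    let e := MeasurableEquiv.piFinSuccAbove (fun _ : Fin (n + 1) => X) 0
    have he : MeasurePreserving e (Measure.pi fun _ : Fin (n + 1) => μ)
        (μ.prod (Measure.pi fun _ : Fin n => μ)) :=
      measurePreserving_piFinSuccAbove (fun _ : Fin (n + 1) => μ) 0
    have hes : ∀ p, e.symm p = Fin.cons p.1 p.2 := fun p => by
      simp [e, MeasurableEquiv.piFinSuccAbove, Fin.insertNthEquiv]
    let F' : X × (Fin n → X) → ℝ := fun p => F (e.symm p)
    have hF' : Measurable F' := hF.comp e.symm.measurable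
    have hM' : ∀ p, |F' p| ≤ M := fun p => hM _
    have h₁ : ∀ a, HasBoundedDiff c fun x => F' (a, x) := by
      intro a i x y hxy
      refine hc i.succ _ _ fun j hj => ?_
      rw [hes, hes]
      cases j using Fin.cases with
      | zero => rfl
      | succ j => exact hxy j fun h => hj (by rw [h])
    have h₂ : ∀ a b, |(∫ x, F' (a, x) ∂(Measure.pi fun _ : Fin n => μ)) -
        ∫ x, F' (b, x) ∂(Measure.pi fun _ : Fin n => μ)| ≤ c := by
      intro a b
      refine abs_integral_sub_integral_le
        (integrable_of_abs_le (hF'.comp measurable_prodMk_left) fun x => hM' (a, x))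
        (integrable_of_abs_le (hF'.comp measurable_prodMk_left) fun x => hM' (b, x))
        fun x => hc 0 _ _ fun j hj => ?_
      rw [hes, hes]
      cases j using Fin.cases with
      | zero => exact absurd rfl hj
      | succ j => rfl
    have hmean : Measurable fun a => ∫ x, F' (a, x) ∂(Measure.pi fun _ : Fin n => μ) :=
      hF'.stronglyMeasurable.integral_prod_right'.measurable
    have := hasSubgaussianMGF_prod hF' hM'
      (fun a => ih (hF'.comp measurable_prodMk_left) (fun x => hM' (a, x)) (h₁ a))
      (hasSubgaussianMGF_of_abs_sub_le (μ := μ) hmean h₂)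
    rw [← he.map_eq] at this
    have := HasSubgaussianMGF.of_map he.measurable.aemeasurable this
    rw [integral_map_equiv] at this
    convert this using 1
    · funext x
      simp [F']
    · push_cast; ring

/-- McDiarmid's inequality for a function of two independent samples. -/
theorem hasSubgaussianMGF_two_samples {n m : ℕ} {μ : Measure X} {ν : Measure Y}
    [IsProbabilityMeasure μ] [IsProbabilityMeasure ν] {F : (Fin n → X) × (Fin m → Y) → ℝ}
    (hF : Measurable F) {M : ℝ} (hM : ∀ p, |F p| ≤ M) {c₁ c₂ : ℝ≥0}
    (h₁ : ∀ y, HasBoundedDiff c₁ fun x => F (x, y))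
    (h₂ : ∀ x, HasBoundedDiff c₂ fun y => F (x, y)) :
    HasSubgaussianMGF
      (fun p => F p - ∫ p', F p' ∂((Measure.pi fun _ => μ).prod (Measure.pi fun _ => ν)))
      (n * (c₁ / 2) ^ 2 + m * (c₂ / 2) ^ 2)
      ((Measure.pi fun _ => μ).prod (Measure.pi fun _ => ν)) := by
  refine hasSubgaussianMGF_prod hF hM
    (fun x => hasSubgaussianMGF_pi (hF.comp measurable_prodMk_left) (fun y => hM (x, y)) (h₂ x))
    (hasSubgaussianMGF_pi hF.stronglyMeasurable.integral_prod_right'.measurable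
      (fun x => abs_integral_le_of_abs_le fun y => hM (x, y)) ?_)
  intro i x x' hxx'
  exact abs_integral_sub_integral_le
    (integrable_of_abs_le (hF.comp measurable_prodMk_left) fun y => hM (x, y))
    (integrable_of_abs_le (hF.comp measurable_prodMk_left) fun y => hM (x', y))
    fun y => h₁ y i x x' hxx'

end McDiarmid

/-! ### Symmetrization -/

section Symmetrization

variable {X κ : Type*} [MeasurableSpace X]

lemma abs_ciSup_le [Nonempty κ] {a : κ → ℝ} {c : ℝ} (h : ∀ k, |a k| ≤ c) : |⨆ k, a k| ≤ c := by
  have hbdd : BddAbove (Set.range a) := ⟨c, by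
    rintro _ ⟨k, rfl⟩
    exact (abs_le.1 (h k)).2⟩
  obtain ⟨k₀⟩ := ‹Nonempty κ›
  exact abs_le.2 ⟨(abs_le.1 (h k₀)).1.trans (le_ciSup hbdd k₀),
    haveI : Nonempty κ := ⟨k₀⟩; ciSup_le fun k => (abs_le.1 (h k)).2⟩

lemma abs_ciSup_sub_ciSup_le [Nonempty κ] {a b : κ → ℝ} (ha : BddAbove (Set.range a))
    (hb : BddAbove (Set.range b)) {c : ℝ} (h : ∀ k, |a k - b k| ≤ c) :
    |(⨆ k, a k) - ⨆ k, b k| ≤ c := by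
  rw [abs_le]
  constructor
  · have : ⨆ k, b k ≤ (⨆ k, a k) + c := ciSup_le fun k => by
      linarith [le_ciSup ha k, (abs_le.1 (h k)).1]
    linarith
  · have : ⨆ k, a k ≤ (⨆ k, b k) + c := ciSup_le fun k => by
      linarith [le_ciSup hb k, (abs_le.1 (h k)).2]
    linarith

/-- A sum of suprema is approached by choosing near-maximizers. -/
lemma sum_ciSup_le [Nonempty κ] {E : Type*} [Fintype E] {a : E → κ → ℝ} {b : ℝ}
    (h : ∀ τ : E → κ, ∑ ε, a ε (τ ε) ≤ b) : ∑ ε, ⨆ k, a ε k ≤ b := by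
  refine le_of_forall_pos_le_add fun η hη => ?_
  have hη' : 0 < η / (Fintype.card E + 1) := by positivity
  choose τ hτ using fun ε => exists_lt_of_lt_ciSup (sub_lt_self (⨆ k, a ε k) hη')
  calc ∑ ε, ⨆ k, a ε k ≤ ∑ ε, (a ε (τ ε) + η / (Fintype.card E + 1)) :=
        Finset.sum_le_sum fun ε _ => by linarith [hτ ε]
    _ ≤ b + η := by
        rw [Finset.sum_add_distrib, Finset.sum_const, Finset.card_univ, nsmul_eq_mul]
        refine add_le_add (h τ) ?_
        rw [mul_div_assoc', div_le_iff₀ (by positivity)]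
        nlinarith

/-- The one-sided uniform deviation `sup_k ∑ᵢ (μ g_k - g_k(Sᵢ))` of an empirical process. -/
def supDev {n : ℕ} (μ : Measure X) (g : κ → X → ℝ) (S : Fin n → X) : ℝ :=
  ⨆ k, ∑ i, ((∫ x, g k x ∂μ) - g k (S i))

variable {n : ℕ} {μ : Measure X} {g : κ → X → ℝ} {M : ℝ}

lemma abs_sum_dev_le [IsProbabilityMeasure μ] (hM : ∀ k x, |g k x| ≤ M) (S : Fin n → X) (k : κ) :
    |∑ i, ((∫ x, g k x ∂μ) - g k (S i))| ≤ n * (2 * M) := by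
  refine (Finset.abs_sum_le_sum_abs _ _).trans
    ((Finset.sum_le_card_nsmul _ _ (2 * M) fun i _ => ?_).trans_eq (by simp))
  refine (abs_sub _ _).trans ?_
  linarith [hM k (S i), abs_integral_le_of_abs_le (μ := μ) (hM k)]

lemma bddAbove_dev [IsProbabilityMeasure μ] (hM : ∀ k x, |g k x| ≤ M) (S : Fin n → X) :
    BddAbove (Set.range fun k => ∑ i, ((∫ x, g k x ∂μ) - g k (S i))) :=
  ⟨n * (2 * M), by
    rintro _ ⟨k, rfl⟩
    exact (abs_le.1 (abs_sum_dev_le hM S k)).2⟩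

lemma abs_supDev_le [Nonempty κ] [IsProbabilityMeasure μ] (hM : ∀ k x, |g k x| ≤ M) (S : Fin n → X) :
    |supDev μ g S| ≤ n * (2 * M) :=
  abs_ciSup_le (abs_sum_dev_le hM S)

lemma measurable_supDev [Countable κ] (hg : ∀ k, Measurable (g k)) :
    Measurable (supDev (n := n) μ g) :=
  Measurable.iSup fun k => Finset.measurable_sum _ fun i _ =>
    ((hg k).comp (measurable_pi_apply i)).const_sub _

lemma sum_dev_le_supDev [IsProbabilityMeasure μ] (hM : ∀ k x, |g k x| ≤ M) (S : Fin n → X) (k : κ) :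
    ∑ i, ((∫ x, g k x ∂μ) - g k (S i)) ≤ supDev μ g S :=
  le_ciSup (bddAbove_dev hM S) k

lemma HasBoundedDiff.sum {X : Type*} {n : ℕ} {u : X → ℝ} {c : ℝ} (h : ∀ x y, |u x - u y| ≤ c) :
    HasBoundedDiff c fun S : Fin n → X => ∑ i, u (S i) := by
  intro i S S' hS
  rw [← Finset.sum_sub_distrib, Finset.sum_eq_single i]
  · exact h _ _
  · intro j _ hj
    rw [hS j hj, sub_self]
  · simp

lemma hasBoundedDiff_supDev [Nonempty κ] [IsProbabilityMeasure μ] (hM : ∀ k x, |g k x| ≤ M) {c : ℝ}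
    (hc : ∀ k x y, |g k x - g k y| ≤ c) : HasBoundedDiff c (supDev (n := n) μ g) := by
  intro i S S' hS
  refine abs_ciSup_sub_ciSup_le (bddAbove_dev hM S) (bddAbove_dev hM S') fun k => ?_
  refine HasBoundedDiff.sum (u := fun x => (∫ x, g k x ∂μ) - g k x) (fun x y => ?_) i S S' hS
  rw [sub_sub_sub_cancel_left, abs_sub_comm]
  exact hc k x y

/-- The symmetrized process on two independent samples. -/
def symDev (g : κ → X → ℝ) (ε : Fin n → Bool) (p : (Fin n → X) × (Fin n → X)) : ℝ :=
  ⨆ k, ∑ i, sgn (ε i) * (g k (p.1 i) - g k (p.2 i))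

lemma abs_sum_sym_le {X κ : Type*} {n : ℕ} {g : κ → X → ℝ} {M : ℝ} (hM : ∀ k x, |g k x| ≤ M) (ε : Fin n → Bool)
    (p : (Fin n → X) × (Fin n → X)) (k : κ) :
    |∑ i, sgn (ε i) * (g k (p.1 i) - g k (p.2 i))| ≤ n * (2 * M) := by
  refine (Finset.abs_sum_le_sum_abs _ _).trans
    ((Finset.sum_le_card_nsmul _ _ (2 * M) fun i _ => ?_).trans_eq (by simp))
  rw [abs_mul, abs_sgn, one_mul]
  refine (abs_sub _ _).trans ?_
  linarith [hM k (p.1 i), hM k (p.2 i)]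

lemma measurable_symDev [Countable κ] (hg : ∀ k, Measurable (g k)) (ε : Fin n → Bool) :
    Measurable (symDev g ε) :=
  Measurable.iSup fun k => Finset.measurable_sum _ fun i _ =>
    (((hg k).comp ((measurable_pi_apply i).comp measurable_fst)).sub
      ((hg k).comp ((measurable_pi_apply i).comp measurable_snd))).const_mul _

lemma integrable_symDev [Nonempty κ] [IsProbabilityMeasure μ] [Countable κ] (hg : ∀ k, Measurable (g k)) (hM : ∀ k x, |g k x| ≤ M)
    (ε : Fin n → Bool) :
    Integrable (symDev g ε) ((Measure.pi fun _ => μ).prod (Measure.pi fun _ => μ)) :=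
  integrable_of_abs_le (measurable_symDev hg ε) fun p => abs_ciSup_le (abs_sum_sym_le hM ε p)

/-- Exchanging the `i`-th points of the two samples does not change their joint law. -/
lemma integral_symDev [IsProbabilityMeasure μ] [Countable κ] (ε : Fin n → Bool) :
    ∫ p, symDev (n := n) g ε p ∂((Measure.pi fun _ => μ).prod (Measure.pi fun _ => μ)) =
      ∫ p, symDev (n := n) g (fun _ => true) p
        ∂((Measure.pi fun _ => μ).prod (Measure.pi fun _ => μ)) := by
  have he := measurePreserving_arrowProdEquivProdArrow X X (Fin n) (fun _ => μ) fun _ => μ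
  have hswap : MeasurePreserving
      (fun (z : Fin n → X × X) i => (if ε i then id else Prod.swap) (z i))
      (Measure.pi fun _ => μ.prod μ) (Measure.pi fun _ => μ.prod μ) := by
    refine measurePreserving_pi (f := fun i => if ε i then id else Prod.swap) _ _ fun i => ?_
    split_ifs
    · exact MeasurePreserving.id _
    · exact Measure.measurePreserving_swap
  let T : (Fin n → X × X) ≃ᵐ (Fin n → X × X) :=
    MeasurableEquiv.piCongrRight fun i =>
      if ε i then MeasurableEquiv.refl _ else MeasurableEquiv.prodComm
  have hT : ∀ z, T z = fun i => (if ε i then id else Prod.swap) (z i) := by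
    intro z
    funext i
    by_cases h : ε i <;> simp [T, h, MeasurableEquiv.piCongrRight]
    rfl
  have hTp : MeasurePreserving T (Measure.pi fun _ => μ.prod μ) (Measure.pi fun _ => μ.prod μ) := by
    convert hswap using 1
    exact funext hT
  rw [← he.integral_comp (MeasurableEquiv.measurableEmbedding _),
    ← he.integral_comp (MeasurableEquiv.measurableEmbedding _),
    ← hTp.integral_comp T.measurableEmbedding]
  refine integral_congr_ae (Filter.Eventually.of_forall fun z => ?_)
  simp only [symDev]
  refine iSup_congr fun k => Finset.sum_congr rfl fun i _ => ?_
  simp only [hT, MeasurableEquiv.arrowProdEquivProdArrow, Equiv.arrowProdEquivProdArrow]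
  by_cases h : ε i <;> simp [h, sgn]

lemma integral_comp_eval_eq [IsProbabilityMeasure μ] (hg : ∀ k, Measurable (g k)) (k : κ) (i : Fin n) :
    ∫ S : Fin n → X, g k (S i) ∂(Measure.pi fun _ => μ) = ∫ x, g k x ∂μ := by
  have h := measurePreserving_eval (fun _ : Fin n => μ) i
  conv_rhs => rw [← h.map_eq]
  rw [integral_map h.measurable.aemeasurable (hg k).aestronglyMeasurable]

/-- A ghost sample replaces the population mean. -/
lemma integral_supDev_le_integral_symDev [Nonempty κ] [IsProbabilityMeasure μ] [Countable κ] (hg : ∀ k, Measurable (g k))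
    (hM : ∀ k x, |g k x| ≤ M) :
    ∫ S : Fin n → X, supDev μ g S ∂(Measure.pi fun _ => μ) ≤
      ∫ p, symDev (n := n) g (fun _ => true) p
        ∂((Measure.pi fun _ => μ).prod (Measure.pi fun _ => μ)) := by
  have hint := integrable_symDev (n := n) (μ := μ) hg hM fun _ => true
  rw [integral_prod_symm _ hint]
  refine integral_mono (integrable_of_abs_le (measurable_supDev hg) (abs_supDev_le hM))
    hint.integral_prod_right fun S => ciSup_le fun k => ?_
  have hi : ∀ i : Fin n, Integrable (fun S' : Fin n → X => g k (S' i))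
      (Measure.pi fun _ => μ) := fun i =>
    integrable_of_abs_le ((hg k).comp (measurable_pi_apply i)) fun S' => hM k _
  have hd : ∀ i : Fin n, Integrable (fun S' : Fin n → X => g k (S' i) - g k (S i))
      (Measure.pi fun _ => μ) := fun i => (hi i).sub (integrable_const _)
  calc ∑ i, ((∫ x, g k x ∂μ) - g k (S i))
      = ∫ S' : Fin n → X, ∑ i, sgn true * (g k (S' i) - g k (S i))
          ∂(Measure.pi fun _ => μ) := by
        rw [integral_finsetSum _ fun i _ => (hd i).const_mul _]
        refine Finset.sum_congr rfl fun i _ => ?_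
        rw [integral_const_mul, integral_sub (hi i) (integrable_const _),
          integral_comp_eval_eq hg]
        simp [sgn]
    _ ≤ _ := by
        refine integral_mono
          (integrable_finsetSum _ fun i _ => (hd i).const_mul _)
          (integrable_of_abs_le ((measurable_symDev hg _).comp measurable_prodMk_right)
            fun S' => abs_ciSup_le (abs_sum_sym_le hM _ _)) fun S' => ?_
        exact le_ciSup (f := fun k => ∑ i, sgn true * (g k (S' i) - g k (S i)))
          ⟨n * (2 * M), by
            rintro _ ⟨k, rfl⟩
            exact (abs_le.1 (abs_sum_sym_le hM (fun _ => true) (S', S) k)).2⟩ k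

/-- Symmetrization: the expected uniform deviation is at most twice the Rademacher complexity. -/
theorem integral_supDev_le [Nonempty κ] [IsProbabilityMeasure μ] [Countable κ] (hg : ∀ k, Measurable (g k)) (hM : ∀ k x, |g k x| ≤ M)
    {b : ℝ} (hb : ∀ (x : Fin n → X) (τ : (Fin n → Bool) → κ),
      ∑ ε, ∑ i, sgn (ε i) * g (τ ε) (x i) ≤ Fintype.card (Fin n → Bool) * b) :
    ∫ S : Fin n → X, supDev μ g S ∂(Measure.pi fun _ => μ) ≤ 2 * b := by
  refine (integral_supDev_le_integral_symDev hg hM).trans ?_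
  have hcard : (0 : ℝ) < Fintype.card (Fin n → Bool) := by
    exact_mod_cast Fintype.card_pos
  refine le_of_mul_le_mul_left ?_ hcard
  calc Fintype.card (Fin n → Bool) * ∫ p, symDev (n := n) g (fun _ => true) p
        ∂((Measure.pi fun _ => μ).prod (Measure.pi fun _ => μ))
      = ∫ p, ∑ ε, symDev (n := n) g ε p
          ∂((Measure.pi fun _ => μ).prod (Measure.pi fun _ => μ)) := by
        rw [integral_finsetSum _ fun ε _ => integrable_symDev hg hM ε]
        simp only [integral_symDev, Finset.sum_const, Finset.card_univ, nsmul_eq_mul]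
    _ ≤ ∫ p : (Fin n → X) × (Fin n → X), Fintype.card (Fin n → Bool) * (2 * b)
          ∂((Measure.pi fun _ => μ).prod (Measure.pi fun _ => μ)) := by
        refine integral_mono (integrable_finsetSum _ fun ε _ => integrable_symDev hg hM ε)
          (integrable_const _) fun p => sum_ciSup_le fun τ => ?_
        have h₁ := hb p.1 τ
        have h₂ := hb p.2 fun ε => τ fun i => !ε i
        rw [← sum_not] at h₂
        simp only [sgn_not, Bool.not_not, neg_mul, Finset.sum_neg_distrib] at h₂
        simp only [mul_sub, Finset.sum_sub_distrib]
        linarith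
    _ = Fintype.card (Fin n → Bool) * (2 * b) := by simp

end Symmetrization

/-! ### Deviation of the non-negative empirical risk -/

section Deviation

variable {X Y : Type*}

lemma HasBoundedDiff.add {n : ℕ} {F G : (Fin n → X) → ℝ} {c c' : ℝ} (hF : HasBoundedDiff c F)
    (hG : HasBoundedDiff c' G) : HasBoundedDiff (c + c') fun S => F S + G S := by
  intro i S S' h
  rw [add_sub_add_comm]
  exact (abs_add_le _ _).trans (add_le_add (hF i S S' h) (hG i S S' h))

lemma HasBoundedDiff.div_nat {n : ℕ} {F : (Fin n → X) → ℝ} {c : ℝ} (hF : HasBoundedDiff c F)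
    (m : ℕ) : HasBoundedDiff (c / m) fun S => F S / m := by
  intro i S S' h
  rw [← sub_div, abs_div, Nat.abs_cast]
  exact div_le_div_of_nonneg_right (hF i S S' h) (Nat.cast_nonneg _)

lemma HasBoundedDiff.mono {n : ℕ} {F : (Fin n → X) → ℝ} {c c' : ℝ} (hF : HasBoundedDiff c F)
    (h : c ≤ c') : HasBoundedDiff c' F :=
  fun i S S' hS => (hF i S S' hS).trans h

/-- The average of `g` over the points of a sample. -/
def avg {n : ℕ} (S : Fin n → X) (g : X → ℝ) : ℝ := (∑ i, g (S i)) / n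

lemma HasBoundedDiff.avg {n : ℕ} {g : X → ℝ} {c : ℝ} (h : ∀ x y, |g x - g y| ≤ c) :
    HasBoundedDiff (c / n) fun S : Fin n → X => avg S g :=
  (HasBoundedDiff.sum h).div_nat n

lemma abs_avg_le {n : ℕ} (S : Fin n → X) {g : X → ℝ} {B : ℝ} (hB : 0 ≤ B)
    (h : ∀ x, |g x| ≤ B) : |avg S g| ≤ B := by
  rw [avg, abs_div, Nat.abs_cast]
  refine div_le_of_le_mul₀ (Nat.cast_nonneg _) hB ?_
  refine (Finset.abs_sum_le_sum_abs _ _).trans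
    ((Finset.sum_le_card_nsmul _ _ B fun _ _ => h _).trans_eq ?_)
  simp [mul_comm]

lemma avg_nonneg {n : ℕ} (S : Fin n → X) {g : X → ℝ} (h : ∀ x, 0 ≤ g x) : 0 ≤ avg S g :=
  div_nonneg (Finset.sum_nonneg fun _ _ => h _) (Nat.cast_nonneg _)

section Oscillation

/-- The modified empirical risk `Ê_de a - C Ê_nu a`. -/
def empMod {n m : ℕ} (C : ℝ) (a : X → ℝ) (S : (Fin n → X) × (Fin m → X)) : ℝ :=
  avg S.2 a - C * avg S.1 a

/-- The non-negative empirical risk of a pair of losses `a`, `c`. -/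
def empNonneg {n m : ℕ} (C : ℝ) (a c : X → ℝ) (S : (Fin n → X) × (Fin m → X)) : ℝ :=
  avg S.1 c + max 0 (empMod C a S)

variable {n m : ℕ} {C B : ℝ} {a c : X → ℝ}

lemma abs_max_zero_le (x : ℝ) : |max 0 x| ≤ |x| := by
  rw [abs_of_nonneg (le_max_left _ _)]
  exact max_le (abs_nonneg _) (le_abs_self _)

lemma abs_empMod_le (hC : 0 ≤ C) (hB : 0 ≤ B) (haB : ∀ x, |a x| ≤ B)
    (S : (Fin n → X) × (Fin m → X)) : |empMod C a S| ≤ B + C * B := by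
  refine (abs_sub _ _).trans (add_le_add (abs_avg_le _ hB haB) ?_)
  rw [abs_mul, abs_of_nonneg hC]
  exact mul_le_mul_of_nonneg_left (abs_avg_le _ hB haB) hC

lemma abs_empNonneg_le (hC : 0 ≤ C) (hB : 0 ≤ B) (haB : ∀ x, |a x| ≤ B) (hcB : ∀ x, |c x| ≤ B)
    (S : (Fin n → X) × (Fin m → X)) : |empNonneg C a c S| ≤ B + (B + C * B) :=
  (abs_add_le _ _).trans (add_le_add (abs_avg_le _ hB hcB)
    ((abs_max_zero_le _).trans (abs_empMod_le hC hB haB S)))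

lemma hasBoundedDiff_empMod_fst {b : ℝ} (hC : 0 ≤ C) (hab : ∀ x y, |a x - a y| ≤ b)
    (y : Fin m → X) : HasBoundedDiff (C * (b / n)) fun x : Fin n → X => empMod C a (x, y) := by
  intro i S S' h
  simp only [empMod, sub_sub_sub_cancel_left, ← mul_sub, abs_mul, abs_of_nonneg hC]
  rw [abs_sub_comm]
  exact mul_le_mul_of_nonneg_left (HasBoundedDiff.avg hab i S S' h) hC

lemma hasBoundedDiff_empMod_snd {b : ℝ} (hab : ∀ x y, |a x - a y| ≤ b)
    (x : Fin n → X) : HasBoundedDiff (b / m) fun y : Fin m → X => empMod C a (x, y) := by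
  intro i S S' h
  simp only [empMod, sub_sub_sub_cancel_right]
  exact HasBoundedDiff.avg hab i S S' h

lemma HasBoundedDiff.max_zero {F : (Fin n → X) → ℝ} {b : ℝ} (hF : HasBoundedDiff b F) :
    HasBoundedDiff b fun S => max 0 (F S) := by
  intro i S S' h
  refine (abs_max_sub_max_le_max _ _ _ _).trans ?_
  rw [sub_self, abs_zero, max_eq_right (abs_nonneg _)]
  exact hF i S S' h

lemma HasBoundedDiff.neg {F : (Fin n → X) → ℝ} {b : ℝ} (hF : HasBoundedDiff b F) :
    HasBoundedDiff b fun S => -F S := by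
  intro i S S' h
  rw [neg_sub_neg, abs_sub_comm]
  exact hF i S S' h

lemma abs_sub_le_of_mem_Icc {s t B : ℝ} (hs : s ∈ Set.Icc 0 B) (ht : t ∈ Set.Icc 0 B) :
    |s - t| ≤ B :=
  abs_le.2 ⟨by linarith [hs.1, ht.2], by linarith [hs.2, ht.1]⟩

end Oscillation

variable [MeasurableSpace X] [MeasurableSpace Y]

lemma measurable_avg {n : ℕ} {g : X → ℝ} (hg : Measurable g) :
    Measurable fun S : Fin n → X => avg S g :=
  (Finset.measurable_sum _ fun i _ => hg.comp (measurable_pi_apply i)).div_const _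

lemma integral_avg {n : ℕ} (hn : 0 < n) {μ : Measure X} [IsProbabilityMeasure μ] {g : X → ℝ}
    (hg : Measurable g) {B : ℝ} (hB : ∀ x, |g x| ≤ B) :
    ∫ S : Fin n → X, avg S g ∂(Measure.pi fun _ => μ) = ∫ x, g x ∂μ := by
  have hn' : (n : ℝ) ≠ 0 := by positivity
  simp only [avg]
  have hi : ∀ i : Fin n, Integrable (fun S : Fin n → X => g (S i)) (Measure.pi fun _ => μ) :=
    fun i => integrable_of_abs_le (hg.comp (measurable_pi_apply i)) fun S => hB _
  rw [integral_div, integral_finsetSum _ fun i _ => hi i]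
  simp only [integral_comp_eval_eq (g := fun _ : Unit => g) (fun _ => hg) ()]
  simp [hn']

/-- McDiarmid's tail bound for a function of two independent samples. -/
lemma measure_two_samples_le {n m : ℕ} {μ : Measure X} {ν : Measure Y}
    [IsProbabilityMeasure μ] [IsProbabilityMeasure ν] {F : (Fin n → X) × (Fin m → Y) → ℝ}
    (hF : Measurable F) {M : ℝ} (hM : ∀ p, |F p| ≤ M) {c₁ c₂ : ℝ} (hc₁ : 0 ≤ c₁) (hc₂ : 0 ≤ c₂)
    (h₁ : ∀ y, HasBoundedDiff c₁ fun x => F (x, y))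
    (h₂ : ∀ x, HasBoundedDiff c₂ fun y => F (x, y)) {t : ℝ} (ht : 0 ≤ t) :
    ((Measure.pi fun _ => μ).prod (Measure.pi fun _ => ν)).real
      {p | t ≤ F p - ∫ p', F p' ∂((Measure.pi fun _ => μ).prod (Measure.pi fun _ => ν))} ≤
      Real.exp (-t ^ 2 / (2 * (n * (c₁ / 2) ^ 2 + m * (c₂ / 2) ^ 2))) := by
  lift c₁ to NNReal using hc₁
  lift c₂ to NNReal using hc₂
  simpa using (hasSubgaussianMGF_two_samples hF hM h₁ h₂).measure_ge_le ht

lemma integral_prod_fst {μ : Measure X} {ν : Measure Y} [IsProbabilityMeasure μ]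
    [IsProbabilityMeasure ν] {F : X → ℝ} : ∫ p, F p.1 ∂(μ.prod ν) = ∫ x, F x ∂μ := by
  simpa using integral_fun_fst (μ := μ) (ν := ν) F

lemma integral_prod_snd {μ : Measure X} {ν : Measure Y} [IsProbabilityMeasure μ]
    [IsProbabilityMeasure ν] {F : Y → ℝ} : ∫ p, F p.2 ∂(μ.prod ν) = ∫ y, F y ∂ν := by
  simpa using integral_fun_snd (μ := μ) (ν := ν) F

section Bias

variable {n m : ℕ} {μ ν : Measure X} [IsProbabilityMeasure μ] [IsProbabilityMeasure ν]
  {C B α : ℝ} {a c : X → ℝ}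

lemma measurable_empMod (ha : Measurable a) :
    Measurable (empMod (n := n) (m := m) C a) :=
  ((measurable_avg ha).comp measurable_snd).sub
    (((measurable_avg ha).comp measurable_fst).const_mul _)

lemma measurable_empNonneg (ha : Measurable a) (hc : Measurable c) :
    Measurable (empNonneg (n := n) (m := m) C a c) :=
  ((measurable_avg hc).comp measurable_fst).add
    (measurable_const.max (measurable_empMod ha))

lemma integral_empMod (hn : 0 < n) (hm : 0 < m) (ha : Measurable a) (haB : ∀ x, |a x| ≤ B) :
    ∫ S, empMod (n := n) (m := m) C a S ∂((Measure.pi fun _ => μ).prod (Measure.pi fun _ => ν)) =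
      (∫ x, a x ∂ν) - C * ∫ x, a x ∂μ := by
  have hB : 0 ≤ B := by
    obtain ⟨x⟩ : Nonempty X := nonempty_of_isProbabilityMeasure μ
    exact (abs_nonneg _).trans (haB x)
  simp only [empMod]
  have h₁ : Integrable (fun S : (Fin n → X) × (Fin m → X) => avg S.1 a)
      ((Measure.pi fun _ => μ).prod (Measure.pi fun _ => ν)) :=
    integrable_of_abs_le ((measurable_avg ha).comp measurable_fst) fun S => abs_avg_le _ hB haB
  have h₂ : Integrable (fun S : (Fin n → X) × (Fin m → X) => avg S.2 a)
      ((Measure.pi fun _ => μ).prod (Measure.pi fun _ => ν)) :=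
    integrable_of_abs_le ((measurable_avg ha).comp measurable_snd) fun S => abs_avg_le _ hB haB
  rw [integral_sub h₂ (h₁.const_mul C), integral_const_mul, integral_prod_fst (F := fun S => avg S a), integral_prod_snd (F := fun S => avg S a),
    integral_avg hn ha haB, integral_avg hm ha haB]

/-- The truncation at zero is inactive unless the modified empirical risk deviates from its mean
by at least `α`, which has exponentially small probability; this bounds the bias of the
non-negative risk. -/
lemma integral_empNonneg_le (hn : 0 < n) (hm : 0 < m) (hC : 0 < C) (ha : Measurable a)
    (hc : Measurable c) (haB : ∀ x, a x ∈ Set.Icc 0 B) (hcB : ∀ x, |c x| ≤ B) (hα : 0 ≤ α)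
    (hmod : α ≤ (∫ x, a x ∂ν) - C * ∫ x, a x ∂μ) :
    ∫ S, empNonneg (n := n) (m := m) C a c S
        ∂((Measure.pi fun _ => μ).prod (Measure.pi fun _ => ν)) ≤
      (∫ x, c x ∂μ) + ((∫ x, a x ∂ν) - C * ∫ x, a x ∂μ) +
        C * B * Real.exp (-(2 * α ^ 2) / (B ^ 2 / m + C ^ 2 * B ^ 2 / n)) := by
  have haB' : ∀ x, |a x| ≤ B := fun x => by rw [abs_of_nonneg (haB x).1]; exact (haB x).2
  have hB : 0 ≤ B := by
    obtain ⟨x⟩ : Nonempty X := nonempty_of_isProbabilityMeasure μ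
    exact (abs_nonneg _).trans (haB' x)
  set P := (Measure.pi fun _ : Fin n => μ).prod (Measure.pi fun _ : Fin m => ν) with hP
  have hmeas := measurable_empMod (n := n) (m := m) (C := C) ha
  let A : Set ((Fin n → X) × (Fin m → X)) := {S | empMod C a S ≤ 0}
  have hA : MeasurableSet A := measurableSet_le hmeas measurable_const
  have htail : P.real A ≤ Real.exp (-(2 * α ^ 2) / (B ^ 2 / m + C ^ 2 * B ^ 2 / n)) := by
    have hosc : ∀ x y, |a x - a y| ≤ B := fun x y => abs_sub_le_of_mem_Icc (haB x) (haB y)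
    have h := measure_two_samples_le (μ := μ) (ν := ν)
      (F := fun S : (Fin n → X) × (Fin m → X) => -empMod C a S) hmeas.neg
      (M := B + C * B) (fun S => by rw [abs_neg]; exact abs_empMod_le hC.le hB haB' S)
      (c₁ := C * (B / n)) (c₂ := B / m) (by positivity) (by positivity)
      (fun y => (hasBoundedDiff_empMod_fst hC.le hosc y).neg)
      (fun x => (hasBoundedDiff_empMod_snd hosc x).neg) hα
    have hn' : (n : ℝ) ≠ 0 := by positivity
    have hm' : (m : ℝ) ≠ 0 := by positivity
    have e : -α ^ 2 / (2 * (n * (C * (B / n) / 2) ^ 2 + m * (B / m / 2) ^ 2)) =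
        -(2 * α ^ 2) / (B ^ 2 / m + C ^ 2 * B ^ 2 / n) := by
      rw [show 2 * (n * (C * (B / n) / 2) ^ 2 + m * (B / m / 2) ^ 2) =
        (B ^ 2 / m + C ^ 2 * B ^ 2 / n) / 2 by field_simp; ring]
      rw [div_div_eq_mul_div]
      ring_nf
    rw [e] at h
    refine le_trans (measureReal_mono fun S hS => ?_) h
    simp only [Set.mem_ofPred_eq, integral_neg]
    rw [integral_empMod hn hm ha haB']
    have : empMod C a S ≤ 0 := hS
    linarith
  have hpt : ∀ S : (Fin n → X) × (Fin m → X), empNonneg C a c S ≤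
      avg S.1 c + empMod C a S + C * B * A.indicator 1 S := by
    intro S
    have hlow : -(C * B) ≤ empMod C a S := by
      have h₁ := avg_nonneg S.2 fun x => (haB x).1
      have h₂ := mul_le_mul_of_nonneg_left (abs_le.1 (abs_avg_le S.1 hB haB')).2 hC.le
      simp only [empMod]
      linarith
    by_cases hS : S ∈ A
    · have : empMod C a S ≤ 0 := hS
      simp only [empNonneg, max_eq_left this, Set.indicator_of_mem hS, Pi.one_apply]
      linarith
    · have : 0 ≤ empMod C a S := (not_le.1 hS).le
      simp only [empNonneg, max_eq_right this, Set.indicator_of_notMem hS]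
      linarith
  have hi₁ : Integrable (fun S : (Fin n → X) × (Fin m → X) => avg S.1 c) P :=
    integrable_of_abs_le ((measurable_avg hc).comp measurable_fst) fun S => abs_avg_le _ hB hcB
  have hi₂ : Integrable (empMod C a) P :=
    integrable_of_abs_le hmeas (abs_empMod_le hC.le hB haB')
  have hi₃ : Integrable (fun S => C * B * A.indicator 1 S) P :=
    ((integrable_const (1 : ℝ)).indicator hA).const_mul _
  have hi₁₂ : Integrable (fun S => avg S.1 c + empMod C a S) P := hi₁.add hi₂
  calc ∫ S, empNonneg C a c S ∂P
      ≤ ∫ S, (avg S.1 c + empMod C a S + C * B * A.indicator 1 S) ∂P :=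
        integral_mono (integrable_of_abs_le (measurable_empNonneg ha hc)
          (abs_empNonneg_le hC.le hB haB' hcB)) (hi₁₂.add hi₃) hpt
    _ = (∫ x, c x ∂μ) + ((∫ x, a x ∂ν) - C * ∫ x, a x ∂μ) + C * B * P.real A := by
        rw [integral_add hi₁₂ hi₃, integral_add hi₁ hi₂, integral_const_mul,
          integral_indicator_one hA, hP, integral_empMod hn hm ha haB',
          integral_prod_fst (F := fun S => avg S c), integral_avg hn hc hcB]
    _ ≤ _ := by gcongr

end Bias

/-- The high-probability bound: uniformly over a countable family of losses, the one-sided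
deviation of the linear empirical risk, plus the non-negative empirical risk of a reference pair
`a₀`, `c₀`, is controlled by the Rademacher complexities, the bias and McDiarmid's inequality. -/
theorem exists_event {κ : Type*} [Countable κ] [Nonempty κ] {n m : ℕ} {μ ν : Measure X}
    [IsProbabilityMeasure μ] [IsProbabilityMeasure ν] {C B α δ b₁ b₂ : ℝ} {a c : κ → X → ℝ}
    {a₀ c₀ : X → ℝ} (hn : 0 < n) (hm : 0 < m) (hC : 0 < C) (hB : 0 < B)
    (ha : ∀ k, Measurable (a k)) (hc : ∀ k, Measurable (c k))
    (ha₀ : Measurable a₀) (hc₀ : Measurable c₀) (haB : ∀ k x, a k x ∈ Set.Icc 0 B)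
    (hcB : ∀ k x, |c k x| ≤ B) (haB₀ : ∀ x, a₀ x ∈ Set.Icc 0 B) (hcB₀ : ∀ x, |c₀ x| ≤ B)
    (hα : 0 ≤ α) (hmod : α ≤ (∫ x, a₀ x ∂ν) - C * ∫ x, a₀ x ∂μ) (hδ : 0 < δ) (hδ1 : δ < 1)
    (hb₁ : ∀ (x : Fin m → X) (τ : (Fin m → Bool) → κ),
      ∑ ε, ∑ i, sgn (ε i) * a (τ ε) (x i) ≤ Fintype.card (Fin m → Bool) * b₁)
    (hb₂ : ∀ (x : Fin n → X) (τ : (Fin n → Bool) → κ),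
      ∑ ε, ∑ i, sgn (ε i) * (c (τ ε) (x i) - C * a (τ ε) (x i)) ≤
        Fintype.card (Fin n → Bool) * b₂) :
    ∃ G : Set ((Fin n → X) × (Fin m → X)), MeasurableSet G ∧
      ENNReal.ofReal (1 - δ) ≤ ((Measure.pi fun _ => μ).prod (Measure.pi fun _ => ν)) G ∧
      ∀ S ∈ G, ∀ k,
        (((∫ x, a k x ∂ν) - avg S.2 (a k)) +
          ((∫ x, (c k x - C * a k x) ∂μ) - avg S.1 fun x => c k x - C * a k x)) +
          (empNonneg C a₀ c₀ S - ((∫ x, c₀ x ∂μ) + ((∫ x, a₀ x ∂ν) - C * ∫ x, a₀ x ∂μ))) ≤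
        2 * b₁ / m + 2 * b₂ / n +
          C * B * Real.exp (-(2 * α ^ 2) / (B ^ 2 / m + C ^ 2 * B ^ 2 / n)) +
          B * Real.sqrt (8 * (1 / m + (1 + C) ^ 2 / n) * Real.log (1 / δ)) := by
  have hnR : (0 : ℝ) < n := by exact_mod_cast hn
  have hmR : (0 : ℝ) < m := by exact_mod_cast hm
  have habs : ∀ {u B : ℝ}, u ∈ Set.Icc 0 B → |u| ≤ B := fun hu => by
    rw [abs_of_nonneg hu.1]; exact hu.2
  let w : κ → X → ℝ := fun k x => c k x - C * a k x
  have hw : ∀ k, Measurable (w k) := fun k => (hc k).sub ((ha k).const_mul _)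
  have hwB : ∀ k x, |w k x| ≤ B + C * B := fun k x => by
    refine (abs_sub _ _).trans (add_le_add (hcB k x) ?_)
    rw [abs_mul, abs_of_pos hC]
    exact mul_le_mul_of_nonneg_left (habs (haB k x)) hC.le
  have hwosc : ∀ k x y, |w k x - w k y| ≤ 2 * B + C * B := fun k x y => by
    have h₁ := abs_le.1 (hcB k x)
    have h₂ := abs_le.1 (hcB k y)
    have h₃ := abs_le.1 (abs_sub_le_of_mem_Icc (haB k x) (haB k y))
    simp only [w]
    rw [abs_le]
    constructor <;> nlinarith
  let F : (Fin n → X) × (Fin m → X) → ℝ := fun S =>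
    (supDev ν a S.2 / m + supDev μ w S.1 / n) + empNonneg C a₀ c₀ S
  set P := (Measure.pi fun _ : Fin n => μ).prod (Measure.pi fun _ : Fin m => ν) with hP
  have hm₁ : Measurable fun S : (Fin n → X) × (Fin m → X) => supDev ν a S.2 / m :=
    ((measurable_supDev ha).comp measurable_snd).div_const _
  have hm₂ : Measurable fun S : (Fin n → X) × (Fin m → X) => supDev μ w S.1 / n :=
    ((measurable_supDev hw).comp measurable_fst).div_const _
  have hm₃ := measurable_empNonneg (n := n) (m := m) (C := C) ha₀ hc₀
  have hM₁ : ∀ S : (Fin n → X) × (Fin m → X), |supDev ν a S.2 / m| ≤ m * (2 * B) / m := fun S => by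
    rw [abs_div, Nat.abs_cast]
    exact div_le_div_of_nonneg_right (abs_supDev_le (fun k x => habs (haB k x)) _) hmR.le
  have hM₂ : ∀ S : (Fin n → X) × (Fin m → X),
      |supDev μ w S.1 / n| ≤ n * (2 * (B + C * B)) / n := fun S => by
    rw [abs_div, Nat.abs_cast]
    exact div_le_div_of_nonneg_right (abs_supDev_le hwB _) hnR.le
  have hM₃ := abs_empNonneg_le (n := n) (m := m) hC.le hB.le (fun x => habs (haB₀ x)) hcB₀
  have hF : Measurable F := (hm₁.add hm₂).add hm₃
  have hFM : ∀ S, |F S| ≤ m * (2 * B) / m + n * (2 * (B + C * B)) / n + (B + (B + C * B)) :=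
    fun S => (abs_add_le _ _).trans
      (add_le_add ((abs_add_le _ _).trans (add_le_add (hM₁ S) (hM₂ S))) (hM₃ S))
  have hosc₀ : ∀ x y, |a₀ x - a₀ y| ≤ B := fun x y => abs_sub_le_of_mem_Icc (haB₀ x) (haB₀ y)
  have hcosc₀ : ∀ x y, |c₀ x - c₀ y| ≤ 2 * B := fun x y =>
    (abs_sub _ _).trans (by linarith [hcB₀ x, hcB₀ y])
  have hconst : ∀ {k : ℕ} (r : ℝ), HasBoundedDiff 0 fun _ : Fin k → X => r := fun r _ _ _ _ => by
    simp
  -- The oscillations found below are `2 (2 + C) B / n` and `2 B / m`; they are relaxed to the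
  -- values for which the variance proxy is `4 B² (1 / m + (1 + C)² / n)`.
  have hd₁ : ∀ y, HasBoundedDiff (4 * (1 + C) * B / n) fun x => F (x, y) := fun y => by
    refine (((hconst (supDev ν a y / m)).add ((hasBoundedDiff_supDev (μ := μ) hwB hwosc).div_nat n)).add
      ((HasBoundedDiff.avg hcosc₀).add
        (hasBoundedDiff_empMod_fst hC.le hosc₀ y).max_zero)).mono ?_
    rw [mul_div_assoc', ← add_div, zero_add, ← add_div]
    exact div_le_div_of_nonneg_right (by nlinarith) hnR.le
  have hd₂ : ∀ x, HasBoundedDiff (4 * B / m) fun y => F (x, y) := fun x => by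
    refine ((((hasBoundedDiff_supDev (μ := ν) (fun k x => habs (haB k x)) fun k x y =>
      abs_sub_le_of_mem_Icc (haB k x) (haB k y)).div_nat m).add (hconst (supDev μ w x / n))).add
      ((hconst (avg x c₀)).add (hasBoundedDiff_empMod_snd hosc₀ x).max_zero)).mono ?_
    rw [add_zero, zero_add, ← add_div]
    exact div_le_div_of_nonneg_right (by linarith) hmR.le
  set A : ℝ := 1 / m + (1 + C) ^ 2 / n with hA
  have hApos : 0 < A := by positivity
  have hlog : 0 < Real.log (1 / δ) := Real.log_pos (by rw [lt_div_iff₀ hδ]; linarith)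
  set t := B * Real.sqrt (8 * A * Real.log (1 / δ)) with ht
  have htail := measure_two_samples_le (μ := μ) (ν := ν) hF hFM (by positivity) (by positivity)
    hd₁ hd₂ (t := t) (by positivity)
  have hexp : Real.exp (-t ^ 2 /
      (2 * (n * (4 * (1 + C) * B / n / 2) ^ 2 + m * (4 * B / m / 2) ^ 2))) = δ := by
    rw [show 2 * (n * (4 * (1 + C) * B / n / 2) ^ 2 + m * (4 * B / m / 2) ^ 2) =
      8 * B ^ 2 * A by rw [hA]; field_simp; ring]
    rw [ht, mul_pow, Real.sq_sqrt (by positivity),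
      show -(B ^ 2 * (8 * A * Real.log (1 / δ))) / (8 * B ^ 2 * A) = -Real.log (1 / δ) by
        field_simp]
    rw [one_div, Real.log_inv, neg_neg, Real.exp_log hδ]
  rw [hexp] at htail
  have hEF : ∫ S, F S ∂P ≤ 2 * b₁ / m + 2 * b₂ / n +
      ((∫ x, c₀ x ∂μ) + ((∫ x, a₀ x ∂ν) - C * ∫ x, a₀ x ∂μ) +
        C * B * Real.exp (-(2 * α ^ 2) / (B ^ 2 / m + C ^ 2 * B ^ 2 / n))) := by
    have hi₁ := integrable_of_abs_le (μ := P) hm₁ hM₁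
    have hi₂ := integrable_of_abs_le (μ := P) hm₂ hM₂
    have hi₁₂ : Integrable (fun S : (Fin n → X) × (Fin m → X) =>
      supDev ν a S.2 / m + supDev μ w S.1 / n) P := hi₁.add hi₂
    rw [integral_add hi₁₂ (integrable_of_abs_le hm₃ hM₃), integral_add hi₁ hi₂,
      integral_div, integral_div, hP, integral_prod_fst (F := supDev μ w),
      integral_prod_snd (F := supDev ν a)]
    gcongr
    · exact integral_supDev_le ha (fun k x => habs (haB k x)) hb₁
    · exact integral_supDev_le hw hwB hb₂
    · exact integral_empNonneg_le hn hm hC ha₀ hc₀ haB₀ hcB₀ hα hmod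
  refine ⟨{S | t ≤ F S - ∫ S', F S' ∂P}ᶜ,
    (measurableSet_le measurable_const (hF.sub_const _)).compl, ?_, fun S hS k => ?_⟩
  · rw [← ofReal_measureReal,
      probReal_compl_eq_one_sub (measurableSet_le measurable_const (hF.sub_const _))]
    exact ENNReal.ofReal_le_ofReal (by linarith)
  · have hS' : F S - ∫ S', F S' ∂P < t := not_le.1 hS
    have hdev : ∀ {l : ℕ} {g : κ → X → ℝ} {M : ℝ} {η : Measure X} [IsProbabilityMeasure η]
        (T : Fin l → X), (0 : ℝ) < l → (∀ k x, |g k x| ≤ M) →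
        (∫ x, g k x ∂η) - avg T (g k) ≤ supDev η g T / l := by
      intro l g M η _ T hl hM
      rw [le_div_iff₀ hl]
      refine le_trans (le_of_eq ?_) (sum_dev_le_supDev hM T k)
      rw [Finset.sum_sub_distrib, avg, sub_mul, div_mul_cancel₀ _ hl.ne']
      simp [mul_comm]
    have h₁ := hdev (η := ν) S.2 hmR fun k x => habs (haB k x)
    have h₂ := hdev (η := μ) S.1 hnR hwB
    simp only [F, w] at hS' h₂
    linarith

end Deviation

/-! ### Densities, and a countable dense subfamily of the class -/

section Reduction

variable {d : ℕ}

lemma IsDensity.isProbabilityMeasure {p : Cov d → ℝ} (hp : IsDensity p) :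
    IsProbabilityMeasure (law p) :=
  ⟨by rw [law, withDensity_apply _ MeasurableSet.univ, Measure.restrict_univ,
    hp.lintegral_eq_one]⟩

lemma IsDensity.measurableSet_domain {p : Cov d → ℝ} (hp : IsDensity p) :
    MeasurableSet (domain p) :=
  measurableSet_lt measurable_const hp.measurable

lemma IsDensity.ae_mem_domain {p : Cov d → ℝ} (hp : IsDensity p) :
    ∀ᵐ x ∂(law p), x ∈ domain p := by
  rw [law, ae_withDensity_iff (hp.measurable.ennreal_ofReal)]
  exact Filter.Eventually.of_forall fun x hx => by
    simpa [domain] using hx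

/-- Continuous functions on a closed ball form a separable space, so every class of them has a
countable uniformly dense subfamily. -/
lemma exists_dense_seq {H : Set (Cov d → ℝ)} (hne : H.Nonempty) (hH : ∀ r ∈ H, Continuous r)
    (R : ℝ) : ∃ r : ℕ → Cov d → ℝ, (∀ k, r k ∈ H) ∧
      ∀ h ∈ H, ∀ η > 0, ∃ k, ∀ x, ‖x‖ ≤ R → |h x - r k x| ≤ η := by
  let K : Set (Cov d) := Metric.closedBall 0 R
  have : CompactSpace K := isCompact_iff_compactSpace.1 (isCompact_closedBall 0 R)
  let T : H → C(K, ℝ) := fun h => ⟨fun x => h.1 x, (hH h.1 h.2).comp continuous_subtype_val⟩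
  obtain ⟨h₀, hh₀⟩ := hne
  have : Nonempty (Set.range T) := ⟨⟨T ⟨h₀, hh₀⟩, ⟨_, rfl⟩⟩⟩
  have hdense := TopologicalSpace.denseRange_denseSeq (Set.range T)
  choose r hr using fun k => (TopologicalSpace.denseSeq (Set.range T) k).2
  refine ⟨fun k => (r k).1, fun k => (r k).2, fun h hh η hη => ?_⟩
  obtain ⟨k, hk⟩ := Metric.denseRange_iff.1 hdense ⟨T ⟨h, hh⟩, ⟨_, rfl⟩⟩ η hη
  refine ⟨k, fun x hx => ?_⟩
  have hxK : x ∈ K := by simpa [K] using hx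
  rw [Subtype.dist_eq, ← hr k] at hk
  exact ((ContinuousMap.dist_apply_le_dist ⟨x, hxK⟩).trans hk.le)

/-- The composition `e ∘ r`, set to zero off `D`, where `r` may leave the interval on which the
losses are controlled. -/
def truncLoss (D : Set (Cov d)) (e : ℝ → ℝ) (r : Cov d → ℝ) : Cov d → ℝ :=
  D.indicator fun x => e (r x)

variable {D : Set (Cov d)} {e : ℝ → ℝ} {r r' : Cov d → ℝ}

lemma truncLoss_of_mem {x : Cov d} (hx : x ∈ D) : truncLoss D e r x = e (r x) :=
  Set.indicator_of_mem hx _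

lemma truncLoss_of_notMem {x : Cov d} (hx : x ∉ D) : truncLoss D e r x = 0 :=
  Set.indicator_of_notMem hx _

lemma measurable_truncLoss (hD : MeasurableSet D) (he : Continuous e) (hr : Continuous r) :
    Measurable (truncLoss D e r) :=
  (he.comp hr).measurable.indicator hD

lemma abs_truncLoss_sub_le {K : NNReal} (he : LipschitzWith K e) {η : ℝ} (hη : 0 ≤ η)
    (h : ∀ x ∈ D, |r x - r' x| ≤ η) (x : Cov d) :
    |truncLoss D e r x - truncLoss D e r' x| ≤ K * η := by
  by_cases hx : x ∈ D
  · rw [truncLoss_of_mem hx, truncLoss_of_mem hx]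
    have := he.dist_le_mul (r x) (r' x)
    rw [Real.dist_eq, Real.dist_eq] at this
    exact this.trans (mul_le_mul_of_nonneg_left (h x hx) K.coe_nonneg)
  · rw [truncLoss_of_notMem hx, truncLoss_of_notMem hx, sub_self, abs_zero]
    positivity

lemma avg_sub_const_mul {n : ℕ} (S : Fin n → Cov d) (g h : Cov d → ℝ) (C : ℝ) :
    avg S (fun x => g x - C * h x) = avg S g - C * avg S h := by
  simp only [avg, Finset.sum_sub_distrib, ← Finset.mul_sum]
  ring

lemma truncLoss_sub_const_mul (D : Set (Cov d)) (e₁ e₂ : ℝ → ℝ) (C : ℝ) (r : Cov d → ℝ)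
    (x : Cov d) : truncLoss D (fun t => e₂ t - C * e₁ t) r x =
      truncLoss D e₂ r x - C * truncLoss D e₁ r x := by
  by_cases hx : x ∈ D
  · simp only [truncLoss_of_mem hx]
  · simp only [truncLoss_of_notMem hx, mul_zero, sub_zero]

/-- Uniformly close functions have close deviations from the mean. -/
lemma dev_le_dev_add {n : ℕ} {μ : Measure (Cov d)} [IsProbabilityMeasure μ] (S : Fin n → Cov d)
    {g h : Cov d → ℝ} (hg : Integrable g μ) (hh : Integrable h μ) {η : ℝ} (hη : 0 ≤ η)
    (hgh : ∀ x, |g x - h x| ≤ η) :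
    (∫ x, g x ∂μ) - avg S g ≤ (∫ x, h x ∂μ) - avg S h + 2 * η := by
  have h₁ := (abs_le.1 (abs_integral_sub_integral_le hg hh hgh)).2
  have h₂ := (abs_le.1 (abs_avg_le S hη hgh)).1
  have h₃ := avg_sub_const_mul S g h 1
  simp only [one_mul] at h₃
  linarith

/-- The Rademacher complexity of truncated Lipschitz losses of networks. Points off `D` do not
contribute and may be moved to the origin. -/
lemma rademacher_truncLoss_le {L : ℕ} (hL : 1 ≤ L) {φ : ℕ → ℝ → ℝ} {BW : ℕ → ℝ} {R : ℝ}
    (hR : 0 ≤ R) (hDR : ∀ x ∈ D, ‖x‖ ≤ R) (hφ : ∀ j ∈ Finset.Ico 1 L, IsActivation (φ j))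
    (hBW : ∀ j ∈ Finset.Icc 1 L, 0 ≤ BW j) {κ : Type*} {r : κ → Cov d → ℝ}
    (hr : ∀ k, r k ∈ networks d φ BW L) {K : NNReal} (he : LipschitzWith K e) {n : ℕ}
    (x : Fin n → Cov d) (τ : (Fin n → Bool) → κ) :
    ∑ ε, ∑ i, sgn (ε i) * truncLoss D e (r (τ ε)) (x i) ≤ Fintype.card (Fin n → Bool) *
      (K * (2 ^ (L - 1) * (∏ j ∈ Finset.Icc 1 L, BW j) * R) * Real.sqrt n) := by
  classical
  have h := rademacher_networks_le hL hR (x := fun i => if x i ∈ D then x i else 0)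
    (fun i => by
      split_ifs with hi
      · exact hDR _ hi
      · simpa using hR) hφ hBW hr K.coe_nonneg (g := fun k i => truncLoss D e (r k) (x i))
    (fun i k k' => by
      by_cases hi : x i ∈ D
      · simp only [truncLoss_of_mem hi, if_pos hi]
        simpa [Real.dist_eq] using he.dist_le_mul (r k (x i)) (r k' (x i))
      · simp only [truncLoss_of_notMem hi, sub_self, abs_zero]
        positivity) τ
  rwa [Fintype.card_fin] at h

end Reduction

/-! ### The risks as functionals of the truncated losses -/

section Risks

variable {d nnu nde : ℕ} {C : ℝ} {f : ℝ → ℝ} {pnu pde : Cov d → ℝ} {I : Set ℝ} {e₁ e₂ : ℝ → ℝ}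
  {D : Set (Cov d)} {r : Cov d → ℝ}

lemma integral_loss_eq {μ : Measure (Cov d)} (hμ : ∀ᵐ x ∂μ, x ∈ D) {ℓ e : ℝ → ℝ}
    (he : Set.EqOn ℓ e I) (hr : ∀ x ∈ D, r x ∈ I) :
    ∫ x, ℓ (r x) ∂μ = ∫ x, truncLoss D e r x ∂μ := by
  refine integral_congr_ae ?_
  filter_upwards [hμ] with x hx
  rw [truncLoss_of_mem hx, he (hr x hx)]

lemma sampleAvg_loss_eq {n : ℕ} {S : Fin n → Cov d} (hS : ∀ i, S i ∈ D) {ℓ e : ℝ → ℝ}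
    (he : Set.EqOn ℓ e I) (hr : ∀ x ∈ D, r x ∈ I) :
    sampleAvg S (fun x => ℓ (r x)) = avg S (truncLoss D e r) := by
  rw [sampleAvg, avg]
  congr 1
  exact Finset.sum_congr rfl fun i _ => by rw [truncLoss_of_mem (hS i), he (hr _ (hS i))]

lemma modRisk_eq (hnu : ∀ᵐ x ∂(law pnu), x ∈ D) (hde : ∀ᵐ x ∂(law pde), x ∈ D)
    (he₁ : Set.EqOn (loss1 f) e₁ I) (hr : ∀ x ∈ D, r x ∈ I) :
    modRisk C f pnu pde r =
      (∫ x, truncLoss D e₁ r x ∂(law pde)) - C * ∫ x, truncLoss D e₁ r x ∂(law pnu) := by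
  rw [modRisk, integral_loss_eq hnu he₁ hr, integral_loss_eq hde he₁ hr]

lemma BR_eq (hnu : ∀ᵐ x ∂(law pnu), x ∈ D) (hde : ∀ᵐ x ∂(law pde), x ∈ D)
    (he₁ : Set.EqOn (loss1 f) e₁ I) (he₂ : Set.EqOn (loss2 C f) e₂ I)
    (hr : ∀ x ∈ D, r x ∈ I) :
    BR f pnu pde r = (∫ x, truncLoss D e₁ r x ∂(law pde)) +
      ∫ x, (truncLoss D e₂ r x - C * truncLoss D e₁ r x) ∂(law pnu) := by
  have h₁ : ∫ x, (deriv f (r x) * r x - f (r x)) ∂(law pde) =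
      ∫ x, truncLoss D e₁ r x ∂(law pde) := integral_loss_eq hde he₁ hr
  have h₂ : ∫ x, deriv f (r x) ∂(law pnu) =
      -∫ x, (truncLoss D e₂ r x - C * truncLoss D e₁ r x) ∂(law pnu) := by
    rw [← integral_neg]
    refine integral_congr_ae ?_
    filter_upwards [hnu] with x hx
    rw [truncLoss_of_mem hx, truncLoss_of_mem hx, ← he₁ (hr x hx), ← he₂ (hr x hx)]
    simp only [loss1, loss2, fTilde]
    ring
  rw [BR, h₁, h₂, sub_neg_eq_add]

/-- On samples inside `D` the non-negative empirical risk only sees the truncated losses. -/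
lemma nnBR_eq {S : Samples d nnu nde} (hS₁ : ∀ i, S.1 i ∈ D) (hS₂ : ∀ i, S.2 i ∈ D)
    (he₁ : Set.EqOn (loss1 f) e₁ I) (he₂ : Set.EqOn (loss2 C f) e₂ I)
    (hr : ∀ x ∈ D, r x ∈ I) :
    nnBR C f S r = empNonneg C (truncLoss D e₁ r) (truncLoss D e₂ r) S := by
  rw [nnBR, sampleAvg_loss_eq hS₁ he₂ hr, sampleAvg_loss_eq hS₁ he₁ hr,
    sampleAvg_loss_eq hS₂ he₁ hr]
  rfl

/-- Almost surely all sample points lie in the domain of the denominator density. -/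
lemma ae_samples_mem [IsProbabilityMeasure (law pnu)] [IsProbabilityMeasure (law pde)]
    (hnu : ∀ᵐ x ∂(law pnu), x ∈ D) (hde : ∀ᵐ x ∂(law pde), x ∈ D) :
    ∀ᵐ S ∂(sampleLaw nnu nde pnu pde), (∀ i, S.1 i ∈ D) ∧ ∀ i, S.2 i ∈ D := by
  have h₁ : ∀ᵐ S ∂(Measure.pi fun _ : Fin nnu => law pnu), ∀ i, S i ∈ D :=
    ae_all_iff.2 fun i =>
      (measurePreserving_eval (fun _ : Fin nnu => law pnu) i).quasiMeasurePreserving.ae hnu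
  have h₂ : ∀ᵐ S ∂(Measure.pi fun _ : Fin nde => law pde), ∀ i, S i ∈ D :=
    ae_all_iff.2 fun i =>
      (measurePreserving_eval (fun _ : Fin nde => law pde) i).quasiMeasurePreserving.ae hde
  rw [sampleLaw]
  filter_upwards [Measure.quasiMeasurePreserving_fst.ae h₁,
    Measure.quasiMeasurePreserving_snd.ae h₂] with S hS₁ hS₂ using ⟨hS₁, hS₂⟩

lemma loss_mem_of_bddAbove {br Br : ℝ} (hB : BddAbove (lossValues C f br Br))
    (hl1 : ∀ t ∈ Set.Ioo br Br, 0 ≤ loss1 f t) {t : ℝ} (ht : t ∈ Set.Ioo br Br) :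
    loss1 f t ∈ Set.Icc 0 (lossBound C f br Br) ∧ |loss2 C f t| ≤ lossBound C f br Br := by
  have h : max |loss1 f t| |loss2 C f t| ≤ lossBound C f br Br := le_csSup hB ⟨t, ht, rfl⟩
  exact ⟨⟨hl1 t ht, (le_abs_self _).trans ((le_max_left _ _).trans h)⟩,
    (le_max_right _ _).trans h⟩

end Risks

end D3RE
end

theorem corollary1
    (C br Br Bp : ℝ) (f : ℝ → ℝ) (L : ℕ) (BW : ℕ → ℝ)
    (hC : 0 < C) (hbr : 0 ≤ br) (hL : 1 ≤ L)
    (hBW : ∀ j ∈ Finset.Icc 1 L, 0 ≤ BW j)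
    -- `f` is a convex `C²` function on `I_r = (br, Br)` with bounded derivative
    (hf : ContDiffOn ℝ 2 f (Set.Ioo br Br))
    (hconv : ConvexOn ℝ (Set.Ioo br Br) f)
    (hf' : ∃ M : ℝ, ∀ t ∈ Set.Ioo br Br, |deriv f t| ≤ M)
    -- `f̃` is bounded from above, `ℓ₁` is non-negative
    (hft : BddAbove (D3RE.fTilde C f '' Set.Ioo br Br))
    (hl1 : ∀ t ∈ Set.Ioo br Br, 0 ≤ D3RE.loss1 f t)
    -- the losses are bounded and Lipschitz on `I_r`
    (hB : BddAbove (D3RE.lossValues C f br Br))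
    (hLip1 : ∃ K : NNReal, LipschitzOnWith K (D3RE.loss1 f) (Set.Ioo br Br))
    (hLip2 : ∃ K : NNReal, LipschitzOnWith K (D3RE.loss2 C f) (Set.Ioo br Br)) :
    ∃ κ₁ κ₂ : ℝ,
      ∀ (d : ℕ) (pnu pde : D3RE.Cov d → ℝ) (φ : ℕ → ℝ → ℝ) (H : Set (D3RE.Cov d → ℝ))
        (rbar : D3RE.Cov d → ℝ) (α : ℝ),
        -- densities, their domains, and the density ratio
        D3RE.IsDensity pnu → D3RE.IsDensity pde →
        D3RE.domain pnu ⊆ D3RE.domain pde →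
        BddAbove (D3RE.ratioValues pnu pde) →
        C < 1 / D3RE.ratioSup pnu pde →
        br < D3RE.ratioSup pnu pde → D3RE.ratioSup pnu pde < Br →
        (∀ x ∈ D3RE.domain pde, ‖x‖ ≤ Bp) →
        -- `H` consists of depth-`L` networks with values in `I_r` on the domain
        (∀ j ∈ Finset.Ico 1 L, D3RE.IsActivation (φ j)) →
        H ⊆ D3RE.networks d φ BW L →
        (∀ r ∈ H, ∀ x ∈ D3RE.domain pde, r x ∈ Set.Ioo br Br) →
        -- `rbar` is a population risk minimizer
        D3RE.IsMinimizer (D3RE.BR f pnu pde) H rbar →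
        -- `inf_{r ∈ H} (E_de - C E_nu) ℓ₁(r(X))` is positive, with positive lower bound `α`
        0 < α → (∀ r ∈ H, α ≤ D3RE.modRisk C f pnu pde r) →
        ∀ (nnu nde : ℕ) (δ : ℝ), 0 < nnu → 0 < nde → 0 < δ → δ < 1 →
          -- an event of probability at least `1 - δ` on which every empirical risk minimizer
          -- satisfies the bound
          ∃ G : Set (D3RE.Samples d nnu nde), MeasurableSet G ∧
            ENNReal.ofReal (1 - δ) ≤ D3RE.sampleLaw nnu nde pnu pde G ∧
            ∀ S ∈ G, ∀ rhat : D3RE.Cov d → ℝ,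
              D3RE.IsMinimizer (D3RE.nnBR C f S) H rhat →
              D3RE.BR f pnu pde rhat - D3RE.BR f pnu pde rbar ≤
                κ₁ / Real.sqrt nde + κ₂ / Real.sqrt nnu +
                  2 * D3RE.biasTerm C (D3RE.lossBound C f br Br) α nnu nde +
                  D3RE.lossBound C f br Br *
                    Real.sqrt (8 * (1 / nde + (1 + C) ^ 2 / nnu) * Real.log (1 / δ)) := by
  obtain ⟨K₁, hK₁⟩ := hLip1
  obtain ⟨K₂, hK₂⟩ := hLip2
  -- Global Lipschitz extensions of the losses spare the values off the interval.
  obtain ⟨e₁, he₁, heq₁⟩ := hK₁.extend_real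
  obtain ⟨e₂, he₂, heq₂⟩ := hK₂.extend_real
  set I := Set.Ioo br Br
  set B := D3RE.lossBound C f br Br
  let K₃ : NNReal := K₂ + C.toNNReal * K₁
  have he₃ : LipschitzWith K₃ fun t => e₂ t - C * e₁ t :=
    he₂.sub ((LipschitzWith.of_dist_le_mul fun s t => by
      rw [Real.dist_eq, ← mul_sub, abs_mul, abs_of_pos hC, NNReal.coe_mul,
        Real.coe_toNNReal C hC.le, mul_assoc]
      exact mul_le_mul_of_nonneg_left (he₁.dist_le_mul s t) hC.le) :
        LipschitzWith (C.toNNReal * K₁) fun t => C * e₁ t)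
  -- The dimension-free bound on the Rademacher complexity of the networks.
  let N : ℝ := 2 ^ (L - 1) * (∏ j ∈ Finset.Icc 1 L, BW j) * |Bp|
  refine ⟨2 * (K₁ * N), 2 * (K₃ * N), ?_⟩
  intro d pnu pde φ H rbar α hpnu hpde hdom _ _ _ _ hBp hφ hH hHI hrbar hα hmod nnu nde δ
    hnnu hnde hδ hδ1
  have := hpnu.isProbabilityMeasure
  have := hpde.isProbabilityMeasure
  let D := D3RE.domain pde
  have hD : MeasurableSet D := hpde.measurableSet_domain
  have hnu : ∀ᵐ x ∂(D3RE.law pnu), x ∈ D := hpnu.ae_mem_domain.mono fun x hx => hdom hx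
  have hde : ∀ᵐ x ∂(D3RE.law pde), x ∈ D := hpde.ae_mem_domain
  have hDR : ∀ x ∈ D, ‖x‖ ≤ |Bp| := fun x hx => (hBp x hx).trans (le_abs_self _)
  have hcont : ∀ r ∈ H, Continuous r := fun r hr =>
    D3RE.continuous_of_mem_networks hL hφ (hH hr)
  have hmeas₁ : ∀ r ∈ H, Measurable (D3RE.truncLoss D e₁ r) := fun r hr =>
    D3RE.measurable_truncLoss hD he₁.continuous (hcont r hr)
  have hmeas₂ : ∀ r ∈ H, Measurable (D3RE.truncLoss D e₂ r) := fun r hr =>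
    D3RE.measurable_truncLoss hD he₂.continuous (hcont r hr)
  have hmod' := hmod rbar hrbar.1
  rw [D3RE.modRisk_eq hnu hde heq₁ (hHI rbar hrbar.1)] at hmod'
  have hB0 : 0 ≤ B := by
    obtain ⟨x, hx⟩ := hde.exists
    exact (abs_nonneg _).trans
      (D3RE.loss_mem_of_bddAbove hB hl1 (hHI rbar hrbar.1 x hx)).2
  have hbd₁ : ∀ r ∈ H, ∀ x, D3RE.truncLoss D e₁ r x ∈ Set.Icc 0 B := fun r hr x => by
    by_cases hx : x ∈ D
    · rw [D3RE.truncLoss_of_mem hx, ← heq₁ (hHI r hr x hx)]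
      exact (D3RE.loss_mem_of_bddAbove hB hl1 (hHI r hr x hx)).1
    · rw [D3RE.truncLoss_of_notMem hx]
      exact ⟨le_rfl, hB0⟩
  have hbd₂ : ∀ r ∈ H, ∀ x, |D3RE.truncLoss D e₂ r x| ≤ B := fun r hr x => by
    by_cases hx : x ∈ D
    · rw [D3RE.truncLoss_of_mem hx, ← heq₂ (hHI r hr x hx)]
      exact (D3RE.loss_mem_of_bddAbove hB hl1 (hHI r hr x hx)).2
    · rwa [D3RE.truncLoss_of_notMem hx, abs_zero]
  have hbd₁' : ∀ r ∈ H, ∀ x, |D3RE.truncLoss D e₁ r x| ≤ B := fun r hr x => by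
    rw [abs_of_nonneg (hbd₁ r hr x).1]
    exact (hbd₁ r hr x).2
  -- A positive modified risk excludes vanishing losses.
  have hBpos : 0 < B := by
    have h₁ := (abs_le.1 (D3RE.abs_integral_le_of_abs_le (μ := D3RE.law pde)
      (hbd₁' rbar hrbar.1))).2
    have h₂ : 0 ≤ ∫ x, D3RE.truncLoss D e₁ rbar x ∂(D3RE.law pnu) :=
      integral_nonneg fun x => (hbd₁ rbar hrbar.1 x).1
    nlinarith
  obtain ⟨r, hrH, hrdense⟩ := D3RE.exists_dense_seq ⟨rbar, hrbar.1⟩ hcont |Bp|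
  obtain ⟨G, hG, hGprob, hGbound⟩ := D3RE.exists_event (μ := D3RE.law pnu) (ν := D3RE.law pde)
    (a := fun k => D3RE.truncLoss D e₁ (r k)) (c := fun k => D3RE.truncLoss D e₂ (r k))
    (a₀ := D3RE.truncLoss D e₁ rbar) (c₀ := D3RE.truncLoss D e₂ rbar)
    (b₁ := K₁ * N * Real.sqrt nde) (b₂ := K₃ * N * Real.sqrt nnu)
    hnnu hnde hC hBpos (fun k => hmeas₁ _ (hrH k)) (fun k => hmeas₂ _ (hrH k))
    (hmeas₁ _ hrbar.1) (hmeas₂ _ hrbar.1) (fun k => hbd₁ _ (hrH k)) (fun k => hbd₂ _ (hrH k))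
    (hbd₁ _ hrbar.1) (hbd₂ _ hrbar.1) hα.le hmod' hδ hδ1
    (fun x τ => D3RE.rademacher_truncLoss_le hL (abs_nonneg _) hDR hφ hBW
      (fun k => hH (hrH k)) he₁ x τ)
    (fun x τ => by
      have h := D3RE.rademacher_truncLoss_le hL (abs_nonneg _) hDR hφ hBW
        (fun k => hH (hrH k)) he₃ x τ
      simpa only [D3RE.truncLoss_sub_const_mul] using h)
  have hmemD : MeasurableSet {S : D3RE.Samples d nnu nde |
      (∀ i, S.1 i ∈ D) ∧ ∀ i, S.2 i ∈ D} := by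
    have h : ∀ n : ℕ, MeasurableSet {S : Fin n → D3RE.Cov d | ∀ i, S i ∈ D} := fun n => by
      simpa [Set.pi] using MeasurableSet.univ_pi (t := fun _ : Fin n => D) fun _ => hD
    exact (measurable_fst (h nnu)).inter (measurable_snd (h nde))
  refine ⟨G ∩ {S | (∀ i, S.1 i ∈ D) ∧ ∀ i, S.2 i ∈ D}, hG.inter hmemD, ?_, ?_⟩
  · rw [measure_inter_conull]
    · exact hGprob
    · exact D3RE.ae_samples_mem hnu hde
  rintro S ⟨hSG, hS₁, hS₂⟩ rhat hrhat
  have hint₁ : ∀ r ∈ H, Integrable (D3RE.truncLoss D e₁ r) (D3RE.law pde) := fun r hr =>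
    D3RE.integrable_of_abs_le (hmeas₁ r hr) (hbd₁' r hr)
  have hint₃ : ∀ r ∈ H, Integrable
      (fun x => D3RE.truncLoss D e₂ r x - C * D3RE.truncLoss D e₁ r x) (D3RE.law pnu) :=
    fun r hr => (D3RE.integrable_of_abs_le (hmeas₂ r hr) (hbd₂ r hr)).sub
      ((D3RE.integrable_of_abs_le (hmeas₁ r hr) (hbd₁' r hr)).const_mul C)
  have hmin : D3RE.nnBR C f S rhat ≤ D3RE.nnBR C f S rbar := hrhat.2 hrbar.1
  rw [D3RE.nnBR_eq hS₁ hS₂ heq₁ heq₂ (hHI _ hrhat.1),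
    D3RE.nnBR_eq hS₁ hS₂ heq₁ heq₂ (hHI _ hrbar.1)] at hmin
  rw [D3RE.BR_eq hnu hde heq₁ heq₂ (hHI _ hrhat.1), D3RE.BR_eq hnu hde heq₁ heq₂ (hHI _ hrbar.1)]
  -- The linear empirical risk of the minimizer is at most its non-negative empirical risk.
  have hlin : D3RE.avg S.2 (D3RE.truncLoss D e₁ rhat) +
      D3RE.avg S.1 (fun x => D3RE.truncLoss D e₂ rhat x - C * D3RE.truncLoss D e₁ rhat x) ≤
      D3RE.empNonneg C (D3RE.truncLoss D e₁ rhat) (D3RE.truncLoss D e₂ rhat) S := by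
    rw [D3RE.avg_sub_const_mul, D3RE.empNonneg]
    have := le_max_right 0 (D3RE.empMod C (D3RE.truncLoss D e₁ rhat) S)
    simp only [D3RE.empMod] at this ⊢
    linarith
  have hBRbar : ∫ x, (D3RE.truncLoss D e₂ rbar x - C * D3RE.truncLoss D e₁ rbar x)
      ∂(D3RE.law pnu) = (∫ x, D3RE.truncLoss D e₂ rbar x ∂(D3RE.law pnu)) -
        C * ∫ x, D3RE.truncLoss D e₁ rbar x ∂(D3RE.law pnu) := by
    rw [integral_sub (D3RE.integrable_of_abs_le (hmeas₂ _ hrbar.1) (hbd₂ _ hrbar.1))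
      ((D3RE.integrable_of_abs_le (hmeas₁ _ hrbar.1) (hbd₁' _ hrbar.1)).const_mul C),
      integral_const_mul]
  have hsqrt : ∀ (K : ℝ) (n : ℕ), 2 * (K * N * Real.sqrt n) / n = 2 * (K * N) / Real.sqrt n :=
    fun K n => by
      rw [← mul_assoc, mul_div_assoc, Real.sqrt_div_self, ← div_eq_mul_inv]
  have hbias : C * B * Real.exp (-(2 * α ^ 2) / (B ^ 2 / nde + C ^ 2 * B ^ 2 / nnu)) ≤
      2 * D3RE.biasTerm C B α nnu nde := by
    rw [D3RE.biasTerm, ← mul_assoc]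
    refine mul_le_mul_of_nonneg_right ?_ (Real.exp_nonneg _)
    nlinarith
  -- The estimator is approximated by the dense sequence, with an arbitrarily small error.
  refine le_of_forall_pos_le_add fun η hη => ?_
  have hK : 0 < 2 * (K₁ : ℝ) + 2 * K₃ + 1 := by positivity
  have hη' : 0 < η / (2 * (K₁ : ℝ) + 2 * K₃ + 1) := by positivity
  set η' := η / (2 * (K₁ : ℝ) + 2 * K₃ + 1) with hη'def
  obtain ⟨k, hk⟩ := hrdense rhat hrhat.1 η' hη'
  have hkD : ∀ x ∈ D, |rhat x - r k x| ≤ η' := fun x hx => hk x (hDR x hx)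
  have hdev₁ := D3RE.dev_le_dev_add S.2 (hint₁ _ hrhat.1) (hint₁ _ (hrH k)) (by positivity)
    (D3RE.abs_truncLoss_sub_le he₁ hη'.le hkD)
  have hdev₃ := D3RE.dev_le_dev_add S.1 (hint₃ _ hrhat.1) (hint₃ _ (hrH k))
    (η := K₃ * η') (by positivity) (fun x => by
      simp only [← D3RE.truncLoss_sub_const_mul]
      exact D3RE.abs_truncLoss_sub_le he₃ hη'.le hkD x)
  have hsmall : 2 * (K₁ * η') + 2 * (K₃ * η') ≤ η := by
    have : (2 * (K₁ : ℝ) + 2 * K₃ + 1) * η' = η := by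
      rw [hη'def]
      field_simp
    nlinarith
  have hmain := hGbound S hSG k
  rw [hsqrt, hsqrt] at hmain
  linarith
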